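/- There exist absolute constants $C>0$ and $c>0$ such that the following holds. Let $n\ge 2$ be an integer and let $w_1,\ldots,w_n$ be real numbers with $\sum_{i=1}^n w_i=0$ and $\sum_{i=1}^n w_i^2=1$. Let $\pi$ be a random permutation uniformly distributed on the symmetric group $S_n$ of $\{1,\ldots,n\}$. Then, for every $L\in\mathbb{R}$, $$\mathbb{P}\Bigl\{\Bigl|\sum_{i=1}^n w_i\,\pi(i)-Ln\Bigr|\le\sqrt{n}\Bigr\}\le\frac{C}{\sqrt{n}}\,e^{-c|L|}.$$ -/

import Mathlib

section Concentration

open Finset BigOperators MeasureTheory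

/-! Write W for the first moment of the randomly permuted weights and S_k for their partial sums, so
W = -∑ S_k by Abel summation. The theorem reduces to the tilted bound `Concentrated`, uniform in the
length: the average of 1{|W - a| ≤ h} exp(tW/n) is at most P h/n. Taking t = ±1/2 with the sign of L
turns the tilt into the factor e^{-|L|/2}. Arbitrary a and h ≥ √n are allowed so that the bound
survives shifting and rescaling in an induction on the length.

The smoothness comes from a continuous model. If U is uniform in the cube, its ordering is a uniform
permutation and, given the ordering, its gaps are uniform in a simplex. Then Y = ∑ w_i U_i equals -∑
S_m g_m, with conditional mean W/(n+1) and conditional variance at most of order Q/n², where Q = ∑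
S_k². The tilted law of Y has bounded density (`exists_integral_cube_gaussian_le`): either no weight
dominates and the characteristic function is integrable, or one coordinate alone smooths enough.
Testing Y against a Gaussian of width h/n and applying Jensen's inequality on each simplex gives the
desired bound for W, but weighted by exp(-Q/(2n)) (`exists_expect_window_mul_exp_le`).

To remove the weight, use 1 ≤ e^K e^{-v} + v/K with v = Q/(2n). It remains to bound the averages of
S_k² against the tilted window. Fix which weights occupy the first k positions; the two blocks are
then permuted independently, and either one block carries a quarter of the variance, so that the
induction hypothesis applies to it, or S_k² is at least a quarter of the shorter length
(`expect_blockPerm_le`). This replaces h/n by h/min(k, n-k), but S_k² has average O(min(k, n-k)/n),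
even with an exponential weight (`expect_sq_mul_exp_partialSum_le`), which compensates exactly. The
result is linear in P with an absolute factor, and choosing K equal to that factor makes the
correction half of the target, closing the induction. -/

/-- The first moment `∑ j, j * v j` of a finite sequence. -/
noncomputable def firstMoment {n : ℕ} (v : Fin n → ℝ) : ℝ := ∑ j : Fin n, ((j : ℕ) : ℝ) * v j

/-- The sum of the first `k` entries of a finite sequence. -/
noncomputable def partialSum {n : ℕ} (v : Fin n → ℝ) (k : ℕ) : ℝ :=
  ∑ j : Fin n, if (j : ℕ) < k then v j else 0

/-- The indicator of the interval of radius `h` around `a`. -/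
noncomputable def window (a h x : ℝ) : ℝ := if |x - a| ≤ h then 1 else 0

lemma window_nonneg (a h x : ℝ) : 0 ≤ window a h x := by
  unfold window; split_ifs <;> norm_num

lemma window_le_one (a h x : ℝ) : window a h x ≤ 1 := by
  unfold window; split_ifs <;> norm_num

lemma window_add (a h x c : ℝ) : window a h (x + c) = window (a - c) h x := by
  unfold window
  rw [show x + c - a = x - (a - c) by ring]

lemma window_mul {s : ℝ} (hs : 0 < s) (a h x : ℝ) :
    window a h (s * x) = window (a / s) (h / s) x := by
  unfold window
  have : |x - a / s| ≤ h / s ↔ |s * x - a| ≤ h := by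
    rw [le_div_iff₀ hs, ← abs_of_pos hs, ← abs_mul, abs_of_pos hs, sub_mul, div_mul_cancel₀ _ hs.ne',
      mul_comm x s]
  simp only [this]

/-! ### Partial sums of randomly permuted weights: sampling without replacement -/

section Permutations

variable {n : ℕ}

lemma partialSum_zero (v : Fin n → ℝ) : partialSum v 0 = 0 := by simp [partialSum]

lemma partialSum_succ (v : Fin n → ℝ) {k : ℕ} (hk : k < n) :
    partialSum v (k + 1) = partialSum v k + v ⟨k, hk⟩ := by
  unfold partialSum
  have : v ⟨k, hk⟩ = ∑ j : Fin n, if j = ⟨k, hk⟩ then v j else 0 := by simp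
  rw [this, ← Finset.sum_add_distrib]
  refine Finset.sum_congr rfl fun j _ => ?_
  by_cases h1 : (j : ℕ) < k
  · have : j ≠ ⟨k, hk⟩ := by rintro rfl; simp at h1
    simp [h1, this, Nat.lt_succ_of_lt h1]
  · by_cases h2 : j = ⟨k, hk⟩
    · subst h2; simp
    · have : ¬ (j : ℕ) < k + 1 := by
        intro h3; apply h2; ext; simp; omega
      simp [h1, h2, this]

lemma firstMoment_eq_neg_sum_partialSum (v : Fin n → ℝ) (hv : ∑ i, v i = 0) :
    firstMoment v = -∑ k ∈ range n, partialSum v k := by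
  unfold partialSum firstMoment
  rw [Finset.sum_comm, eq_neg_iff_add_eq_zero, ← Finset.sum_add_distrib]
  have : ∀ j : Fin n, ((j : ℕ) : ℝ) * v j + ∑ k ∈ range n, (if (j : ℕ) < k then v j else 0)
      = ((n : ℝ) - 1) * v j := by
    intro j
    rw [← Finset.sum_filter, Finset.sum_const, nsmul_eq_mul, ← add_mul]
    have : (range n).filter (fun k => (j : ℕ) < k) = Finset.Ioo (j : ℕ) n := by
      ext k; simp; tauto
    rw [this, Nat.card_Ioo]
    have h := j.2
    rw [show n - (j : ℕ) - 1 = n - ((j : ℕ) + 1) by omega, Nat.cast_sub h]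
    push_cast; ring
  rw [Finset.sum_congr rfl fun j _ => this j, ← Finset.mul_sum, hv, mul_zero]

lemma sum_comp_perm (w : Fin n → ℝ) (σ : Equiv.Perm (Fin n)) : ∑ i, (w ∘ σ) i = ∑ i, w i :=
  Equiv.sum_comp σ w

lemma sum_sq_comp_perm (w : Fin n → ℝ) (σ : Equiv.Perm (Fin n)) :
    ∑ i, (w ∘ σ) i ^ 2 = ∑ i, w i ^ 2 :=
  Equiv.sum_comp σ fun i => w i ^ 2

lemma abs_le_one_of_sum_sq_le_one (v : Fin n → ℝ) (hv : ∑ i, v i ^ 2 ≤ 1) (i : Fin n) :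
    |v i| ≤ 1 := by
  rw [← sq_le_one_iff_abs_le_one]
  exact (Finset.single_le_sum (f := fun i => v i ^ 2) (fun i _ => sq_nonneg _) (mem_univ i)).trans hv

lemma expect_perm_comp (F : Equiv.Perm (Fin n) → ℝ) (τ : Equiv.Perm (Fin n)) :
    𝔼 σ, F (σ * τ) = 𝔼 σ, F σ :=
  Fintype.expect_equiv (Equiv.mulRight τ) _ _ fun _ => rfl

lemma partialSum_comp_swap (v : Fin n → ℝ) {k : ℕ} (i j : Fin n) (hi : k ≤ i) (hj : k ≤ j) :
    partialSum (v ∘ Equiv.swap i j) k = partialSum v k := by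
  unfold partialSum
  refine Finset.sum_congr rfl fun m _ => ?_
  split_ifs with h
  · have h1 : m ≠ i := by rintro rfl; omega
    have h2 : m ≠ j := by rintro rfl; omega
    simp [Equiv.swap_apply_of_ne_of_ne h1 h2]
  · rfl

/-- The indices of a sequence of length `n` from position `k` on. -/
def tailIndices (n k : ℕ) : Finset (Fin n) := Finset.univ.filter fun j => k ≤ (j : ℕ)

lemma sum_exp_tail_le (v : Fin n → ℝ) (hv : ∑ i, v i = 0) (hq : ∑ i, v i ^ 2 ≤ 1) {t : ℝ}
    (ht : |t| ≤ 1) {k : ℕ} (hk : k < n) :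
    ∑ j ∈ tailIndices n k, Real.exp (t * v j) ≤ (n - k) + (t ^ 2 - t * partialSum v k) := by
  have hcard : ((tailIndices n k).card : ℝ) = n - k := by
    have : tailIndices n k = Finset.Ici ⟨k, hk⟩ := by
      ext j; simp [tailIndices, Fin.le_def]
    rw [this, Fin.card_Ici, Nat.cast_sub hk.le]
  have hS : ∑ j ∈ tailIndices n k, v j = -partialSum v k := by
    rw [eq_neg_iff_add_eq_zero, partialSum, tailIndices, Finset.sum_filter, ← Finset.sum_add_distrib]
    refine Eq.trans ?_ hv
    refine Finset.sum_congr rfl fun j _ => ?_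
    by_cases h : k ≤ (j : ℕ)
    · simp [h, not_lt.2 h]
    · simp [h, not_le.1 h]
  have hQ : ∑ j ∈ tailIndices n k, v j ^ 2 ≤ 1 :=
    (Finset.sum_le_sum_of_subset_of_nonneg (Finset.filter_subset _ _)
      fun i _ _ => sq_nonneg (v i)).trans hq
  calc ∑ j ∈ tailIndices n k, Real.exp (t * v j)
      ≤ ∑ j ∈ tailIndices n k, (1 + t * v j + t ^ 2 * v j ^ 2) := by
        refine Finset.sum_le_sum fun j _ => ?_
        have h1 : |t * v j| ≤ 1 := by
          rw [abs_mul]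
          exact mul_le_one₀ ht (abs_nonneg _) (abs_le_one_of_sum_sq_le_one v hq j)
        have h2 := (abs_le.1 (Real.abs_exp_sub_one_sub_id_le h1)).2
        nlinarith
    _ = (n - k) + (t * (-partialSum v k)) + t ^ 2 * ∑ j ∈ tailIndices n k, v j ^ 2 := by
        rw [Finset.sum_add_distrib, Finset.sum_add_distrib, ← Finset.mul_sum, ← Finset.mul_sum, hS,
          Finset.sum_const, nsmul_eq_mul, mul_one, hcard]
    _ ≤ _ := by nlinarith [sq_nonneg t]

/-- Given the first k entries, the next one is uniform among the remaining ones, whose mean is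
-S_k/(n-k). The drift contracts S_k by 1 - 1/(n-k), and the fluctuation costs t²/(n-k) in the
exponent. Exchangeability enters through the swaps of position k with each later position. -/
lemma expect_exp_partialSum_succ (w : Fin n → ℝ) (hw : ∑ i, w i = 0) (hq : ∑ i, w i ^ 2 ≤ 1)
    {t : ℝ} (ht : |t| ≤ 1) {k : ℕ} (hk : k < n) :
    𝔼 σ : Equiv.Perm (Fin n), Real.exp (t * partialSum (w ∘ σ) (k + 1))
      ≤ Real.exp (t ^ 2 / (n - k)) *
        𝔼 σ : Equiv.Perm (Fin n), Real.exp (t * (1 - 1 / (n - k)) * partialSum (w ∘ σ) k) := by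
  have hm : (0 : ℝ) < n - k := by
    have : (k : ℝ) < n := by exact_mod_cast hk
    linarith
  have hcard : ((tailIndices n k).card : ℝ) = n - k := by
    have : tailIndices n k = Finset.Ici ⟨k, hk⟩ := by
      ext j; simp [tailIndices, Fin.le_def]
    rw [this, Fin.card_Ici, Nat.cast_sub hk.le]
  have key : ∀ j : Fin n, k ≤ (j : ℕ) →
      𝔼 σ : Equiv.Perm (Fin n), Real.exp (t * partialSum (w ∘ σ) (k + 1))
        = 𝔼 σ : Equiv.Perm (Fin n), Real.exp (t * partialSum (w ∘ σ) k) * Real.exp (t * (w ∘ σ) j) := by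
    intro j hj
    rw [← expect_perm_comp _ (Equiv.swap ⟨k, hk⟩ j)]
    refine Finset.expect_congr rfl fun σ _ => ?_
    rw [partialSum_succ _ hk, mul_add, Real.exp_add, Equiv.Perm.coe_mul, ← Function.comp_assoc,
      partialSum_comp_swap _ _ _ le_rfl hj]
    simp
  have hsum : (n - k : ℝ) * 𝔼 σ : Equiv.Perm (Fin n), Real.exp (t * partialSum (w ∘ σ) (k + 1))
      = 𝔼 σ : Equiv.Perm (Fin n), Real.exp (t * partialSum (w ∘ σ) k) *
          ∑ j ∈ tailIndices n k, Real.exp (t * (w ∘ σ) j) := by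
    simp_rw [Finset.mul_sum]
    rw [Finset.expect_sum_comm, ← hcard, ← nsmul_eq_mul, ← Finset.sum_const]
    refine Finset.sum_congr rfl fun j hj => ?_
    exact key j (by simpa [tailIndices] using hj)
  rw [← mul_le_mul_iff_right₀ hm, hsum, Finset.mul_expect, Finset.mul_expect]
  refine Finset.expect_le_expect fun σ _ => ?_
  have h1 := sum_exp_tail_le (w ∘ σ) (by rw [sum_comp_perm, hw]) (by rwa [sum_sq_comp_perm]) ht hk
  set S := partialSum (w ∘ σ) k
  have h2 : (n - k : ℝ) + (t ^ 2 - t * S) ≤ (n - k) * Real.exp ((t ^ 2 - t * S) / (n - k)) := by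
    have := Real.add_one_le_exp ((t ^ 2 - t * S) / (n - k))
    have h3 := mul_le_mul_of_nonneg_left this hm.le
    rw [mul_add, mul_div_cancel₀ _ hm.ne'] at h3
    linarith
  calc _ ≤ Real.exp (t * S) * ((n - k) * Real.exp ((t ^ 2 - t * S) / (n - k))) :=
        mul_le_mul_of_nonneg_left (h1.trans h2) (Real.exp_pos _).le
    _ = _ := by
        rw [mul_left_comm, ← Real.exp_add, ← Real.exp_add]
        congr 2; field_simp; ring

/-- Iterate the one-step bound: up to the midpoint n - k ≥ n/2, so each step costs at most 2t²/n,
and the contraction only decreases |t|. -/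
lemma expect_exp_partialSum_le_of_two_mul_le (w : Fin n → ℝ) (hw : ∑ i, w i = 0)
    (hq : ∑ i, w i ^ 2 ≤ 1) (k : ℕ) (hk : 2 * k ≤ n) : ∀ t : ℝ, |t| ≤ 1 →
    𝔼 σ : Equiv.Perm (Fin n), Real.exp (t * partialSum (w ∘ σ) k)
      ≤ Real.exp (2 * t ^ 2 * k / n) := by
  induction k with
  | zero =>
    intro t _
    simp [partialSum_zero]
  | succ k ih =>
    intro t ht
    have hkn : k < n := by omega
    have hn : (0 : ℝ) < n := by exact_mod_cast (by omega : 0 < n)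
    have hkr : 2 * ((k : ℝ) + 1) ≤ n := by exact_mod_cast hk
    have hm : (1 : ℝ) ≤ n - k := by linarith [(Nat.cast_nonneg k : (0 : ℝ) ≤ k)]
    have hc0 : 0 ≤ 1 - 1 / ((n : ℝ) - k) := by
      rw [sub_nonneg, div_le_one (by linarith)]; exact hm
    have hc1 : 1 - 1 / ((n : ℝ) - k) ≤ 1 := by
      have : 0 ≤ 1 / ((n : ℝ) - k) := by positivity
      linarith
    set c := 1 - 1 / ((n : ℝ) - k)
    have htc : |t * c| ≤ 1 := by
      rw [abs_mul, abs_of_nonneg hc0]; exact mul_le_one₀ ht hc0 hc1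
    refine (expect_exp_partialSum_succ w hw hq ht hkn).trans ?_
    refine (mul_le_mul_of_nonneg_left (ih (by omega) _ htc) (Real.exp_pos _).le).trans ?_
    rw [← Real.exp_add, Real.exp_le_exp]
    have h1 : t ^ 2 / ((n : ℝ) - k) ≤ 2 * t ^ 2 / n := by
      rw [div_le_div_iff₀ (by linarith) hn]
      nlinarith [sq_nonneg t]
    have h2 : 2 * (t * c) ^ 2 * k / n ≤ 2 * t ^ 2 * k / n := by
      have : (t * c) ^ 2 ≤ t ^ 2 := by
        rw [mul_pow]; exact mul_le_of_le_one_right (sq_nonneg t) (pow_le_one₀ hc0 hc1)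
      gcongr
    have h3 : 2 * t ^ 2 * ((k + 1 : ℕ) : ℝ) / n = 2 * t ^ 2 / n + 2 * t ^ 2 * k / n := by
      push_cast; ring
    rw [h3]; linarith

lemma partialSum_eq_neg_partialSum_rev (v : Fin n → ℝ) (hv : ∑ i, v i = 0) {k : ℕ} (hk : k ≤ n) :
    partialSum v k = -partialSum (v ∘ Fin.revPerm) (n - k) := by
  rw [eq_neg_iff_add_eq_zero]
  have : partialSum (v ∘ Fin.revPerm) (n - k) = ∑ j : Fin n, if (j : ℕ) < k then 0 else v j := by
    unfold partialSum
    refine Fintype.sum_equiv Fin.revPerm _ _ fun j => ?_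
    have hj := j.2
    have : (j : ℕ) < n - k ↔ ¬ ((Fin.revPerm j : Fin n) : ℕ) < k := by
      simp [Fin.val_rev]; omega
    by_cases h : (j : ℕ) < n - k
    · rw [if_pos h, if_neg (this.1 h)]; rfl
    · rw [if_neg h, if_pos (by by_contra h'; exact h (this.2 h'))]
  rw [this, partialSum, ← Finset.sum_add_distrib]
  refine Eq.trans ?_ hv
  refine Finset.sum_congr rfl fun j _ => ?_
  split_ifs <;> simp

/-- Exponential moments of sampling without replacement. -/
lemma expect_exp_partialSum_le (w : Fin n → ℝ) (hw : ∑ i, w i = 0)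
    (hq : ∑ i, w i ^ 2 ≤ 1) {k : ℕ} (hk : k ≤ n) {t : ℝ} (ht : |t| ≤ 1) :
    𝔼 σ : Equiv.Perm (Fin n), Real.exp (t * partialSum (w ∘ σ) k)
      ≤ Real.exp (2 * (min k (n - k) : ℕ) / n) := by
  have ht2 : t ^ 2 ≤ 1 := by rwa [sq_le_one_iff_abs_le_one]
  rcases Nat.le_total (2 * k) n with h | h
  · refine (expect_exp_partialSum_le_of_two_mul_le w hw hq k h t ht).trans ?_
    rw [Real.exp_le_exp, min_eq_left (by omega)]
    have : t ^ 2 * (k : ℝ) ≤ 1 * k := by gcongr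
    gcongr; linarith
  -- Past the midpoint, reverse the order: S_k is minus the sum of the last n - k entries.
  · have h2 := expect_exp_partialSum_le_of_two_mul_le w hw hq (n - k) (by omega) (-t) (by rwa [abs_neg])
    rw [← expect_perm_comp _ (Fin.revPerm : Equiv.Perm (Fin n))] at h2
    have h3 : ∀ σ : Equiv.Perm (Fin n), Real.exp (t * partialSum (w ∘ σ) k)
        = Real.exp (-t * partialSum (w ∘ ⇑(σ * (Fin.revPerm : Equiv.Perm (Fin n)))) (n - k)) := by
      intro σ
      rw [partialSum_eq_neg_partialSum_rev (w ∘ σ) (by rw [sum_comp_perm, hw]) hk,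
        Equiv.Perm.coe_mul, ← Function.comp_assoc]
      congr 1; ring
    rw [Finset.expect_congr rfl fun σ _ => h3 σ]
    refine h2.trans ?_
    rw [Real.exp_le_exp, min_eq_right (by omega)]
    have : t ^ 2 * ((n - k : ℕ) : ℝ) ≤ 1 * (n - k : ℕ) := by gcongr
    rw [neg_sq]
    gcongr; linarith

/-- By Abel summation W/n is the average of the -S_k, so convexity of exp reduces to single partial
sums, where 2 min(k, n-k) ≤ n. -/
lemma expect_exp_firstMoment_le (w : Fin n → ℝ) (hn : 0 < n) (hw : ∑ i, w i = 0)
    (hq : ∑ i, w i ^ 2 ≤ 1) {t : ℝ} (ht : |t| ≤ 1) :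
    𝔼 σ : Equiv.Perm (Fin n), Real.exp (t * firstMoment (w ∘ σ) / n) ≤ Real.exp 1 := by
  have hnr : (0 : ℝ) < n := by exact_mod_cast hn
  have h1 : ∀ σ : Equiv.Perm (Fin n), Real.exp (t * firstMoment (w ∘ σ) / n)
      ≤ ∑ k ∈ range n, (1 / n : ℝ) * Real.exp (-t * partialSum (w ∘ σ) k) := by
    intro σ
    have := convexOn_exp.map_sum_le (t := range n) (w := fun _ => (1 / n : ℝ))
      (p := fun k => -t * partialSum (w ∘ σ) k) (fun _ _ => by positivity)
      (by simp [hnr.ne']) (fun _ _ => Set.mem_univ _)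
    simp only [smul_eq_mul] at this
    refine le_trans (le_of_eq ?_) this
    rw [firstMoment_eq_neg_sum_partialSum _ (by rw [sum_comp_perm, hw]), ← Finset.mul_sum,
      ← Finset.mul_sum]
    congr 1; ring
  refine (Finset.expect_le_expect fun σ _ => h1 σ).trans ?_
  rw [Finset.expect_sum_comm]
  have h2 : ∀ k ∈ range n, 𝔼 σ : Equiv.Perm (Fin n),
      (1 / n : ℝ) * Real.exp (-t * partialSum (w ∘ σ) k) ≤ (1 / n : ℝ) * Real.exp 1 := by
    intro k hk
    rw [← Finset.mul_expect]
    refine mul_le_mul_of_nonneg_left ?_ (by positivity)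
    refine (expect_exp_partialSum_le w hw hq (Finset.mem_range.1 hk).le (by rwa [abs_neg])).trans ?_
    rw [Real.exp_le_exp, div_le_one hnr]
    have : 2 * min k (n - k) ≤ n := by omega
    exact_mod_cast this
  refine (Finset.sum_le_sum h2).trans ?_
  rw [Finset.sum_const, card_range, nsmul_eq_mul, ← mul_assoc, mul_one_div_cancel hnr.ne', one_mul]

/-- The right side vanishes to second order at 0. Subtracting the constant 2 is what turns
exponential moments close to 1 into a small second moment. -/
lemma sq_mul_exp_le (x : ℝ) :
    x ^ 2 * Real.exp (|x| / 2) ≤ 4 * (Real.exp (1 * x) + Real.exp (-1 * x) - 2) := by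
  wlog hx : 0 ≤ x with H
  · have := H (-x) (by linarith)
    rw [abs_neg, neg_sq] at this
    refine this.trans (le_of_eq ?_)
    ring_nf
  rw [abs_of_nonneg hx]
  obtain ⟨z, rfl⟩ : ∃ z, x = 4 * z := ⟨x / 4, by ring⟩
  have hz : 0 ≤ z := by linarith
  have h1 : z * Real.exp z ≤ Real.sinh (2 * z) := by
    rw [Real.sinh_two_mul]
    have h2 : z ≤ Real.sinh z := Real.self_le_sinh_iff.2 hz
    have h3 : Real.exp z ≤ 2 * Real.cosh z := by
      rw [Real.cosh_eq]; linarith [Real.exp_pos (-z)]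
    calc z * Real.exp z ≤ Real.sinh z * (2 * Real.cosh z) :=
          mul_le_mul h2 h3 (Real.exp_pos _).le (hz.trans h2)
      _ = _ := by ring
  have h4 : Real.exp (1 * (4 * z)) + Real.exp (-1 * (4 * z)) - 2 = 4 * Real.sinh (2 * z) ^ 2 := by
    rw [Real.sinh_eq, show 1 * (4 * z) = 2 * z + 2 * z by ring,
      show -1 * (4 * z) = -(2 * z) + -(2 * z) by ring, Real.exp_add, Real.exp_add]
    have : Real.exp (2 * z) * Real.exp (-(2 * z)) = 1 := by rw [← Real.exp_add]; simp
    linear_combination (2) * this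
  have h5 : (z * Real.exp z) ^ 2 ≤ Real.sinh (2 * z) ^ 2 := by gcongr
  rw [h4, show 4 * z / 2 = z + z by ring, Real.exp_add]
  nlinarith

lemma expect_sq_mul_exp_partialSum_le (w : Fin n → ℝ) (hw : ∑ i, w i = 0)
    (hq : ∑ i, w i ^ 2 ≤ 1) {k : ℕ} (hn : 0 < n) (hk : k ≤ n) :
    𝔼 σ : Equiv.Perm (Fin n), partialSum (w ∘ σ) k ^ 2 * Real.exp (|partialSum (w ∘ σ) k| / 2)
      ≤ 32 * ((min k (n - k) : ℕ) / n) := by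
  have hnr : (0 : ℝ) < n := by exact_mod_cast hn
  refine (Finset.expect_le_expect fun σ _ => sq_mul_exp_le _).trans ?_
  rw [← Finset.mul_expect, Finset.expect_sub_distrib, Finset.expect_add_distrib,
    Fintype.expect_const]
  have h1 := expect_exp_partialSum_le w hw hq hk (t := 1) (by simp)
  have h2 := expect_exp_partialSum_le w hw hq hk (t := -1) (by simp)
  have h3 : ((min k (n - k) : ℕ) : ℝ) / n ≤ 1 / 2 := by
    rw [div_le_div_iff₀ hnr (by norm_num)]
    have : min k (n - k) * 2 ≤ 1 * n := by omega
    exact_mod_cast this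
  rw [mul_div_assoc] at h1 h2
  set x := ((min k (n - k) : ℕ) : ℝ) / n
  have h0 : 0 ≤ x := by positivity
  have h4 := (abs_le.1 (Real.abs_exp_sub_one_sub_id_le (x := 2 * x)
    (by rw [abs_of_nonneg (by linarith)]; linarith))).2
  nlinarith

end Permutations

/-- The tilted concentration bound, with constant `P`, for all normalized weights of length `n`. -/
def Concentrated (P : ℝ) (n : ℕ) : Prop :=
  ∀ w : Fin n → ℝ, ∑ i, w i = 0 → ∑ i, w i ^ 2 = 1 → ∀ t a h : ℝ, |t| ≤ 1 / 2 → Real.sqrt n ≤ h →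
    𝔼 σ : Equiv.Perm (Fin n), window a h (firstMoment (w ∘ σ)) *
      Real.exp (t / n * firstMoment (w ∘ σ)) ≤ P * (h / n)

/-! ### Splitting into two independently permuted blocks -/

section Blocks

lemma firstMoment_smul {n : ℕ} (c : ℝ) (v : Fin n → ℝ) : firstMoment (c • v) = c * firstMoment v := by
  simp only [firstMoment, Finset.mul_sum, Pi.smul_apply, smul_eq_mul]
  exact Finset.sum_congr rfl fun _ _ => by ring

/-- Normalizing by √q ≤ 1 widens the window to h/√q, which keeps it admissible, and shrinks the
tilt. -/
lemma Concentrated.scaled {P : ℝ} {k : ℕ} (hP : Concentrated P k) (hk : 0 < k) (v : Fin k → ℝ)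
    (hv : ∑ i, v i = 0) (hq0 : 0 < ∑ i, v i ^ 2) (hq1 : ∑ i, v i ^ 2 ≤ 1) {μ a h : ℝ}
    (hμ : |μ| * k ≤ 1 / 2) (hh : Real.sqrt k ≤ h) :
    𝔼 σ : Equiv.Perm (Fin k), window a h (firstMoment (v ∘ σ)) *
      Real.exp (μ * firstMoment (v ∘ σ)) ≤ P * (h / (Real.sqrt (∑ i, v i ^ 2) * k)) := by
  set q := ∑ i, v i ^ 2
  have hs : 0 < Real.sqrt q := Real.sqrt_pos.2 hq0
  have hs1 : Real.sqrt q ≤ 1 := Real.sqrt_le_one.2 hq1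
  have hkr : (0 : ℝ) < k := by exact_mod_cast hk
  have hvw : v = Real.sqrt q • ((Real.sqrt q)⁻¹ • v) := by
    rw [smul_smul, mul_inv_cancel₀ hs.ne', one_smul]
  have h1 : ∑ i, ((Real.sqrt q)⁻¹ • v) i = 0 := by
    simp only [Pi.smul_apply, smul_eq_mul, ← Finset.mul_sum, hv, mul_zero]
  have h2 : ∑ i, ((Real.sqrt q)⁻¹ • v) i ^ 2 = 1 := by
    simp only [Pi.smul_apply, smul_eq_mul, mul_pow, ← Finset.mul_sum]
    rw [inv_pow, Real.sq_sqrt hq0.le]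
    exact inv_mul_cancel₀ hq0.ne'
  have h3 : |μ * k * Real.sqrt q| ≤ 1 / 2 := by
    rw [abs_mul, abs_mul, abs_of_pos hkr, abs_of_pos hs]
    exact (mul_le_of_le_one_right (by positivity) hs1).trans hμ
  have hh0 : 0 ≤ h := (Real.sqrt_nonneg _).trans hh
  have h4 : Real.sqrt k ≤ h / Real.sqrt q := by
    rw [le_div_iff₀ hs]
    exact (mul_le_of_le_one_right (Real.sqrt_nonneg _) hs1).trans hh
  have h5 := hP _ h1 h2 (μ * k * Real.sqrt q) (a / Real.sqrt q) (h / Real.sqrt q) h3 h4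
  rw [div_div] at h5
  refine le_trans (le_of_eq (Finset.expect_congr rfl fun σ _ => ?_)) h5
  have h6 : firstMoment (v ∘ σ) = Real.sqrt q * firstMoment (((Real.sqrt q)⁻¹ • v) ∘ σ) := by
    rw [← firstMoment_smul]
    congr 1
    conv_lhs => rw [hvw]
    rfl
  rw [h6, window_mul hs]
  congr 2
  field_simp

/-- The permutation of `Fin (k + l)` that permutes the first `k` and the last `l` elements. -/
def blockPerm {k l : ℕ} (τ₁ : Equiv.Perm (Fin k)) (τ₂ : Equiv.Perm (Fin l)) :
    Equiv.Perm (Fin (k + l)) :=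
  finSumFinEquiv.permCongr (Equiv.Perm.sumCongr τ₁ τ₂)

lemma blockPerm_castAdd {k l : ℕ} (τ₁ : Equiv.Perm (Fin k)) (τ₂ : Equiv.Perm (Fin l)) (i : Fin k) :
    blockPerm τ₁ τ₂ (Fin.castAdd l i) = Fin.castAdd l (τ₁ i) := by
  simp [blockPerm, Equiv.permCongr_apply]

lemma blockPerm_natAdd {k l : ℕ} (τ₁ : Equiv.Perm (Fin k)) (τ₂ : Equiv.Perm (Fin l)) (i : Fin l) :
    blockPerm τ₁ τ₂ (Fin.natAdd k i) = Fin.natAdd k (τ₂ i) := by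
  simp [blockPerm, Equiv.permCongr_apply]

/-- A finite sequence minus its mean. -/
noncomputable def center {k : ℕ} (v : Fin k → ℝ) : Fin k → ℝ := fun i => v i - (∑ j, v j) / k

lemma sum_center {k : ℕ} (hk : 0 < k) (v : Fin k → ℝ) : ∑ i, center v i = 0 := by
  have : (k : ℝ) ≠ 0 := by exact_mod_cast hk.ne'
  simp [center, Finset.sum_sub_distrib, mul_div_cancel₀ _ this]

lemma sum_sq_center {k : ℕ} (hk : 0 < k) (v : Fin k → ℝ) :
    ∑ i, center v i ^ 2 = ∑ i, v i ^ 2 - (∑ i, v i) ^ 2 / k := by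
  have : (k : ℝ) ≠ 0 := by exact_mod_cast hk.ne'
  simp only [center, sub_sq, Finset.sum_add_distrib, Finset.sum_sub_distrib, ← Finset.sum_mul,
    ← Finset.mul_sum, Finset.sum_const, card_univ, Fintype.card_fin, nsmul_eq_mul]
  field_simp; ring

lemma firstMoment_comp_eq_center {k : ℕ} (hk : 0 < k) (v : Fin k → ℝ) (τ : Equiv.Perm (Fin k)) :
    firstMoment (v ∘ τ) = firstMoment (center v ∘ τ) + (∑ i, v i) * (k - 1) / 2 := by
  have hk' : (k : ℝ) ≠ 0 := by exact_mod_cast hk.ne'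
  have h : ∑ j : Fin k, ((j : ℕ) : ℝ) = k * (k - 1) / 2 := by
    rw [Fin.sum_univ_eq_sum_range (fun j => (j : ℝ)) k]
    have := Finset.sum_range_id_mul_two k
    have h2 : ((∑ i ∈ range k, i : ℕ) : ℝ) * 2 = k * ((k - 1 : ℕ) : ℝ) := by exact_mod_cast this
    rw [Nat.cast_sub hk] at h2
    push_cast at h2; linarith
  simp only [firstMoment, Function.comp, center, mul_sub, Finset.sum_sub_distrib, ← Finset.sum_mul,
    h]
  field_simp; ring

lemma partialSum_add {k l : ℕ} (v : Fin (k + l) → ℝ) :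
    partialSum v k = ∑ i, v (Fin.castAdd l i) := by
  simp [partialSum, Fin.sum_univ_add]

lemma firstMoment_comp_blockPerm {k l : ℕ} (hk : 0 < k) (hl : 0 < l) (v : Fin (k + l) → ℝ)
    (hv : ∑ i, v i = 0) (τ₁ : Equiv.Perm (Fin k)) (τ₂ : Equiv.Perm (Fin l)) :
    firstMoment (v ∘ blockPerm τ₁ τ₂) =
      firstMoment (center (v ∘ Fin.castAdd l) ∘ τ₁) + firstMoment (center (v ∘ Fin.natAdd k) ∘ τ₂)
        + -(partialSum v k * (k + l) / 2) := by
  have h1 := firstMoment_comp_eq_center hk (v ∘ Fin.castAdd l) τ₁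
  have h2 := firstMoment_comp_eq_center hl (v ∘ Fin.natAdd k) τ₂
  have h3 : firstMoment (v ∘ blockPerm τ₁ τ₂) = firstMoment ((v ∘ Fin.castAdd l) ∘ τ₁) +
      (k * ∑ i, v (Fin.natAdd k i) + firstMoment ((v ∘ Fin.natAdd k) ∘ τ₂)) := by
    simp only [firstMoment, Fin.sum_univ_add, Function.comp, blockPerm_castAdd, blockPerm_natAdd,
      Fin.val_castAdd, Fin.val_natAdd, Nat.cast_add, add_mul, Finset.sum_add_distrib,
      ← Finset.mul_sum]
    rw [Equiv.sum_comp τ₂ fun i => v (Fin.natAdd k i)]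
  have h4 := partialSum_add v
  rw [Fin.sum_univ_add, ← h4] at hv
  simp only [Function.comp] at h1 h2 h3 ⊢
  rw [h3, h1, h2, ← h4, eq_neg_of_add_eq_zero_right hv]
  ring

lemma partialSum_comp_blockPerm {k l : ℕ} (v : Fin (k + l) → ℝ) (τ₁ : Equiv.Perm (Fin k))
    (τ₂ : Equiv.Perm (Fin l)) : partialSum (v ∘ blockPerm τ₁ τ₂) k = partialSum v k := by
  simp only [partialSum_add, Function.comp, blockPerm_castAdd]
  exact Equiv.sum_comp τ₁ fun i => v (Fin.castAdd l i)

lemma sum_sq_center_add_sum_sq_center {k l : ℕ} (hk : 0 < k) (hl : 0 < l) (v : Fin (k + l) → ℝ)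
    (hv : ∑ i, v i = 0) :
    ∑ i, center (v ∘ Fin.castAdd l) i ^ 2 + ∑ i, center (v ∘ Fin.natAdd k) i ^ 2 =
      ∑ i, v i ^ 2 - partialSum v k ^ 2 * (1 / k + 1 / l) := by
  have h4 := partialSum_add v
  rw [Fin.sum_univ_add, ← h4] at hv
  rw [sum_sq_center hk, sum_sq_center hl, Fin.sum_univ_add]
  simp only [Function.comp]
  rw [← h4, eq_neg_of_add_eq_zero_right hv]
  ring

/-- Concentration of X at every centre is insensitive to an independent shift by Y, which
contributes only its exponential moment. -/
lemma expect_expect_window_le {ι κ : Type*} [Fintype ι] [Fintype κ] (X : ι → ℝ) (Y : κ → ℝ)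
    {μ h B M c : ℝ} (hB0 : 0 ≤ B)
    (hB : ∀ a, 𝔼 i, window a h (X i) * Real.exp (μ * X i) ≤ B)
    (hM : 𝔼 j, Real.exp (μ * Y j) ≤ M) (a : ℝ) :
    𝔼 i, 𝔼 j, window a h (X i + Y j + c) * Real.exp (μ * (X i + Y j + c))
      ≤ Real.exp (μ * c) * (B * M) := by
  rw [Finset.expect_comm]
  have h1 : ∀ j, 𝔼 i, window a h (X i + Y j + c) * Real.exp (μ * (X i + Y j + c))
      ≤ Real.exp (μ * c) * (B * Real.exp (μ * Y j)) := by
    intro j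
    have : ∀ i, window a h (X i + Y j + c) * Real.exp (μ * (X i + Y j + c))
        = window (a - (Y j + c)) h (X i) * Real.exp (μ * X i) *
          (Real.exp (μ * Y j) * Real.exp (μ * c)) := by
      intro i
      rw [add_assoc, window_add, mul_add, mul_add, Real.exp_add, Real.exp_add, mul_assoc]
    rw [Finset.expect_congr rfl fun i _ => this i, ← Finset.expect_mul]
    calc _ ≤ B * (Real.exp (μ * Y j) * Real.exp (μ * c)) :=
          mul_le_mul_of_nonneg_right (hB _) (by positivity)
      _ = _ := by ring
  refine (Finset.expect_le_expect fun j _ => h1 j).trans ?_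
  rw [← Finset.mul_expect, ← Finset.mul_expect]
  gcongr

lemma expect_exp_mul_firstMoment_le {n : ℕ} (w : Fin n → ℝ) (hn : 0 < n) (hw : ∑ i, w i = 0)
    (hq : ∑ i, w i ^ 2 ≤ 1) {μ : ℝ} (hμ : |μ| * n ≤ 1) :
    𝔼 σ : Equiv.Perm (Fin n), Real.exp (μ * firstMoment (w ∘ σ)) ≤ Real.exp 1 := by
  have hnr : (0 : ℝ) < n := by exact_mod_cast hn
  have := expect_exp_firstMoment_le w hn hw hq (t := μ * n) (by rwa [abs_mul, abs_of_pos hnr])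
  refine le_trans (le_of_eq (Finset.expect_congr rfl fun σ _ => ?_)) this
  congr 1; field_simp

lemma expect_window_mul_exp_le {ι : Type*} [Fintype ι] (X : ι → ℝ) {μ h M : ℝ}
    (hM : 𝔼 j, Real.exp (μ * X j) ≤ M) (a : ℝ) :
    𝔼 i, window a h (X i) * Real.exp (μ * X i) ≤ M :=
  (Finset.expect_le_expect fun _ _ =>
    mul_le_of_le_one_left (Real.exp_pos _).le (window_le_one _ _ _)).trans hM

/-- The centred blocks have total variance 1 - S²(1/k + 1/l). A block with variance at least 1/4
supplies the concentration, and the other one its exponential moment. If neither has it, S² is at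
least min(k, l)/4 and the trivial bound on the window suffices. The prefactor is the tilt of the
deterministic shift -S(k+l)/2. -/
lemma expect_blockPerm_le {P : ℝ} {k l : ℕ} (hk : 0 < k) (hl : 0 < l) (hPe : Real.exp 1 ≤ P)
    (hPk : Concentrated P k) (hPl : Concentrated P l) (v : Fin (k + l) → ℝ) (hv : ∑ i, v i = 0)
    (hq : ∑ i, v i ^ 2 = 1) {t h : ℝ} (a : ℝ) (ht : |t| ≤ 1 / 2)
    (hh : Real.sqrt (k + l : ℕ) ≤ h) :
    𝔼 τ₁ : Equiv.Perm (Fin k), 𝔼 τ₂ : Equiv.Perm (Fin l),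
      window a h (firstMoment (v ∘ blockPerm τ₁ τ₂)) *
        Real.exp (t / (k + l : ℕ) * firstMoment (v ∘ blockPerm τ₁ τ₂))
    ≤ Real.exp (|partialSum v k| / 4) *
        (Real.exp 1 * P * (2 + 4 * partialSum v k ^ 2) * (h / (min k l : ℕ))) := by
  simp_rw [firstMoment_comp_blockPerm hk hl v hv]
  have hkr : (0 : ℝ) < k := by exact_mod_cast hk
  have hlr : (0 : ℝ) < l := by exact_mod_cast hl
  have hP0 : 0 < P := (Real.exp_pos 1).trans_le hPe
  have hsum := sum_sq_center_add_sum_sq_center hk hl v hv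
  rw [hq] at hsum
  have hc1 := sum_center hk (v ∘ Fin.castAdd l)
  have hc2 := sum_center hl (v ∘ Fin.natAdd k)
  set v₁ := center (v ∘ Fin.castAdd l)
  set v₂ := center (v ∘ Fin.natAdd k)
  have hq1 : 0 ≤ ∑ i, v₁ i ^ 2 := Finset.sum_nonneg fun _ _ => sq_nonneg _
  have hq2 : 0 ≤ ∑ i, v₂ i ^ 2 := Finset.sum_nonneg fun _ _ => sq_nonneg _
  set S := partialSum v k
  have hS : 0 ≤ S ^ 2 * (1 / k + 1 / l : ℝ) := by positivity
  have hmin : (0 : ℝ) < (min k l : ℕ) := by exact_mod_cast lt_min hk hl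
  have hmk : ((min k l : ℕ) : ℝ) ≤ k := by exact_mod_cast min_le_left k l
  have hml : ((min k l : ℕ) : ℝ) ≤ l := by exact_mod_cast min_le_right k l
  set m : ℝ := ((min k l : ℕ) : ℝ)
  have hn1 : (1 : ℝ) ≤ (k + l : ℕ) := by exact_mod_cast (by omega : 1 ≤ k + l)
  have hh1 : 1 ≤ h := (Real.one_le_sqrt.2 hn1).trans hh
  have hμ : |t / (k + l : ℕ)| * (k + l) ≤ 1 / 2 := by
    rw [abs_div, abs_of_pos (by linarith : (0 : ℝ) < (k + l : ℕ))]
    push_cast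
    rw [div_mul_cancel₀ _ (by positivity)]; exact ht
  have hμc : t / (k + l : ℕ) * -(S * (k + l) / 2) ≤ |S| / 4 := by
    have : t / (k + l : ℕ) * -(S * (k + l) / 2) = -(t * S) / 2 := by
      push_cast; field_simp
    rw [this]
    have h1 : |t * S| ≤ 1 / 2 * |S| := by rw [abs_mul]; gcongr
    linarith [neg_abs_le (t * S)]
  set μ := t / (k + l : ℕ)
  have hμk : |μ| * k ≤ 1 / 2 := by nlinarith [abs_nonneg μ]
  have hμl : |μ| * l ≤ 1 / 2 := by nlinarith [abs_nonneg μ]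
  have hhk : Real.sqrt k ≤ h := (Real.sqrt_le_sqrt (by push_cast; linarith)).trans hh
  have hhl : Real.sqrt l ≤ h := (Real.sqrt_le_sqrt (by push_cast; linarith)).trans hh
  have hM1 := expect_exp_mul_firstMoment_le v₁ hk hc1 (by linarith) (μ := μ) (by linarith)
  have hM2 := expect_exp_mul_firstMoment_le v₂ hl hc2 (by linarith) (μ := μ) (by linarith)
  have hscale : ∀ {q r : ℝ}, 1 / 4 ≤ q → m ≤ r →
      P * (h / (Real.sqrt q * r)) ≤ P * (2 * (h / m)) := by
    intro q r hq hr
    have h1 : 1 / 2 ≤ Real.sqrt q := Real.le_sqrt_of_sq_le (by linarith)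
    have h2 : h / (Real.sqrt q * r) ≤ h / (1 / 2 * m) := by gcongr
    have h3 : h / (1 / 2 * m) = 2 * (h / m) := by field_simp
    rw [h3] at h2
    gcongr
  have hlast : P * (2 * (h / m)) * Real.exp 1 ≤ Real.exp 1 * P * (2 + 4 * S ^ 2) * (h / m) := by
    have : 0 ≤ Real.exp 1 * P * (4 * S ^ 2) * (h / m) := by positivity
    linarith
  refine le_trans ?_ (mul_le_mul_of_nonneg_right (Real.exp_le_exp.2 hμc) (by positivity))
  by_cases g1 : 1 / 4 ≤ ∑ i, v₁ i ^ 2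
  · refine (expect_expect_window_le (fun τ₁ : Equiv.Perm (Fin k) => firstMoment (v₁ ∘ τ₁))
      (fun τ₂ : Equiv.Perm (Fin l) => firstMoment (v₂ ∘ τ₂)) (B := P * (2 * (h / m)))
      (by positivity) (fun a => ?_) hM2 a).trans ?_
    · exact (hPk.scaled hk v₁ hc1 (by linarith) (by linarith) hμk hhk).trans (hscale g1 hmk)
    · gcongr
  by_cases g2 : 1 / 4 ≤ ∑ i, v₂ i ^ 2
  · rw [Finset.expect_comm]
    simp_rw [fun (x : Equiv.Perm (Fin k)) (y : Equiv.Perm (Fin l)) =>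
      add_comm (firstMoment (v₁ ∘ x)) (firstMoment (v₂ ∘ y))]
    refine (expect_expect_window_le (fun τ₁ : Equiv.Perm (Fin l) => firstMoment (v₂ ∘ τ₁))
      (fun τ₂ : Equiv.Perm (Fin k) => firstMoment (v₁ ∘ τ₂)) (B := P * (2 * (h / m)))
      (by positivity) (fun a => ?_) hM1 a).trans ?_
    · exact (hPl.scaled hl v₂ hc2 (by linarith) (by linarith) hμl hhl).trans (hscale g2 hml)
    · gcongr
  · push Not at g1 g2
    refine (expect_expect_window_le (fun τ₁ : Equiv.Perm (Fin k) => firstMoment (v₁ ∘ τ₁))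
      (fun τ₂ : Equiv.Perm (Fin l) => firstMoment (v₂ ∘ τ₂)) (B := Real.exp 1)
      (Real.exp_pos _).le (fun a => expect_window_mul_exp_le _ hM1 a) hM2 a).trans ?_
    refine mul_le_mul_of_nonneg_left ?_ (Real.exp_pos _).le
    have h1 : (1 : ℝ) / k + 1 / l ≤ 2 / m := by
      have e1 : (1 : ℝ) / k ≤ 1 / m := by gcongr
      have e2 : (1 : ℝ) / l ≤ 1 / m := by gcongr
      have e3 : 2 / m = 1 / m + 1 / m := by ring
      linarith
    have h2 : 1 ≤ 4 * S ^ 2 * (1 / m) := by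
      have : S ^ 2 * (1 / k + 1 / l : ℝ) ≤ S ^ 2 * (2 / m) := by gcongr
      have e3 : S ^ 2 * (2 / m) = 2 * (S ^ 2 * (1 / m)) := by ring
      linarith
    have h3 : (1 : ℝ) / m ≤ h / m := by gcongr
    calc Real.exp 1 * Real.exp 1 = Real.exp 1 * Real.exp 1 * 1 := (mul_one _).symm
      _ ≤ Real.exp 1 * P * ((2 + 4 * S ^ 2) * (h / m)) := by
        have : 4 * S ^ 2 * (1 / m) ≤ (2 + 4 * S ^ 2) * (h / m) := by
          gcongr; linarith
        gcongr; linarith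
      _ = _ := by ring

lemma expect_eq_expect_blockPerm {k l : ℕ} (F : Equiv.Perm (Fin (k + l)) → ℝ) :
    𝔼 σ, F σ = 𝔼 σ, 𝔼 τ₁ : Equiv.Perm (Fin k), 𝔼 τ₂ : Equiv.Perm (Fin l), F (σ * blockPerm τ₁ τ₂) := by
  rw [Finset.expect_comm]
  simp_rw [Finset.expect_comm (t := (Finset.univ : Finset (Equiv.Perm (Fin l)))), expect_perm_comp,
    Fintype.expect_const]

lemma expect_sq_partialSum_mul_window_le {P : ℝ} {n k : ℕ} (hk : 0 < k) (hkn : k < n)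
    (hPe : Real.exp 1 ≤ P) (hPk : Concentrated P k) (hPl : Concentrated P (n - k)) (w : Fin n → ℝ)
    (hw : ∑ i, w i = 0) (hq : ∑ i, w i ^ 2 = 1) {t h : ℝ} (a : ℝ) (ht : |t| ≤ 1 / 2)
    (hh : Real.sqrt n ≤ h) :
    𝔼 σ : Equiv.Perm (Fin n), partialSum (w ∘ σ) k ^ 2 * (window a h (firstMoment (w ∘ σ)) *
        Real.exp (t / n * firstMoment (w ∘ σ)))
    ≤ 4096 * Real.exp 1 * P * (h / n) := by
  obtain ⟨l, rfl⟩ : ∃ l, n = k + l := ⟨n - k, by omega⟩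
  have hl : 0 < l := by omega
  rw [Nat.add_sub_cancel_left] at hPl
  have hP0 : 0 < P := (Real.exp_pos 1).trans_le hPe
  have hh0 : 0 ≤ h := (Real.sqrt_nonneg _).trans hh
  have hmin : (0 : ℝ) < (min k l : ℕ) := by exact_mod_cast lt_min hk hl
  rw [expect_eq_expect_blockPerm]
  have h1 : ∀ σ : Equiv.Perm (Fin (k + l)), 𝔼 τ₁ : Equiv.Perm (Fin k), 𝔼 τ₂ : Equiv.Perm (Fin l),
      partialSum (w ∘ ⇑(σ * blockPerm τ₁ τ₂)) k ^ 2 *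
        (window a h (firstMoment (w ∘ ⇑(σ * blockPerm τ₁ τ₂))) *
        Real.exp (t / (k + l : ℕ) * firstMoment (w ∘ ⇑(σ * blockPerm τ₁ τ₂))))
      ≤ (128 * Real.exp 1 * P * (h / (min k l : ℕ))) *
        (partialSum (w ∘ σ) k ^ 2 * Real.exp (|partialSum (w ∘ σ) k| / 2)) := by
    intro σ
    simp_rw [Equiv.Perm.coe_mul, ← Function.comp_assoc, partialSum_comp_blockPerm,
      ← Finset.mul_expect]
    have h2 := expect_blockPerm_le hk hl hPe hPk hPl (w ∘ σ) (by rw [sum_comp_perm, hw])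
      (by rw [sum_sq_comp_perm, hq]) a ht hh
    refine (mul_le_mul_of_nonneg_left h2 (sq_nonneg _)).trans ?_
    set S := partialSum (w ∘ σ) k
    -- The polynomial is absorbed into a second factor exp(|S|/4), giving the weight exp(|S|/2)
    -- controlled by the moment bound; the final constant is 4096 = 128 · 32.
    have h3 : 2 + 4 * S ^ 2 ≤ 128 * Real.exp (|S| / 4) := by
      have := Real.quadratic_le_exp_of_nonneg (x := |S| / 4) (by positivity)
      have e : (|S| / 4) ^ 2 = S ^ 2 / 16 := by rw [div_pow, sq_abs]; norm_num
      rw [e] at this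
      linarith [abs_nonneg S]
    rw [show |S| / 2 = |S| / 4 + |S| / 4 by ring, Real.exp_add]
    calc _ = S ^ 2 * Real.exp (|S| / 4) * (Real.exp 1 * P * (h / (min k l : ℕ))) *
          (2 + 4 * S ^ 2) := by ring
      _ ≤ S ^ 2 * Real.exp (|S| / 4) * (Real.exp 1 * P * (h / (min k l : ℕ))) *
          (128 * Real.exp (|S| / 4)) := by gcongr
      _ = _ := by ring
  refine (Finset.expect_le_expect fun σ _ => h1 σ).trans ?_
  rw [← Finset.mul_expect]
  have h4 := expect_sq_mul_exp_partialSum_le w hw hq.le (k := k) (by omega) hkn.le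
  rw [Nat.add_sub_cancel_left] at h4
  refine (mul_le_mul_of_nonneg_left h4 (by positivity)).trans (le_of_eq ?_)
  field_simp; ring

end Blocks

/-! ### Decay of the tilted characteristic function of one uniform variable -/

section Sinc

lemma sin_sq_mul_le (y : ℝ) : Real.sin y ^ 2 * (1 + y ^ 2 / 4) ≤ y ^ 2 := by
  by_cases hy : |y / 2| ≤ Real.pi / 2
  · rw [abs_le] at hy
    have h1 : Real.sin (y / 2) ^ 2 ≤ (y / 2) ^ 2 := sq_le_sq.2 Real.abs_sin_le_abs
    have hc0 : 0 ≤ Real.cos (y / 2) := Real.cos_nonneg_of_neg_pi_div_two_le_of_le hy.1 hy.2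
    have h2 : Real.cos (y / 2) ^ 2 * (1 + y ^ 2 / 4) ≤ 1 := by
      have := Real.cos_le_one_div_sqrt_sq_add_one (x := y / 2)
        (by linarith [hy.1, Real.pi_pos]) (by linarith [hy.2, Real.pi_pos])
      have h3 : Real.cos (y / 2) ^ 2 ≤ (1 / Real.sqrt ((y / 2) ^ 2 + 1)) ^ 2 := by gcongr
      rw [div_pow, Real.sq_sqrt (by positivity), one_pow, le_div_iff₀ (by positivity)] at h3
      linarith
    have h3 : Real.sin y = 2 * Real.sin (y / 2) * Real.cos (y / 2) := by
      rw [← Real.sin_two_mul]; congr 1; ring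
    rw [h3]
    have : 0 ≤ Real.cos (y / 2) ^ 2 * (1 + y ^ 2 / 4) := by positivity
    calc _ = 4 * (Real.sin (y / 2) ^ 2 * (Real.cos (y / 2) ^ 2 * (1 + y ^ 2 / 4))) := by ring
      _ ≤ 4 * ((y / 2) ^ 2 * 1) := by gcongr
      _ = _ := by ring
  · push Not at hy
    have h1 : 3 ^ 2 ≤ y ^ 2 := by
      rw [← sq_abs y]
      have : |y / 2| = |y| / 2 := by rw [abs_div]; norm_num
      rw [this] at hy
      have : 3 ≤ |y| := by linarith [Real.pi_gt_three]
      gcongr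
    have h2 := Real.sin_sq_le_one y
    nlinarith

lemma sinh_sq_le {x : ℝ} (hx : 2 * x ^ 2 ≤ 1) : Real.sinh x ^ 2 ≤ x ^ 2 + 2 * x ^ 4 := by
  have h1 : Real.cosh (2 * x) = 1 + 2 * Real.sinh x ^ 2 := by
    rw [Real.cosh_two_mul, Real.cosh_sq]; ring
  have h2 := Real.cosh_le_exp_half_sq (2 * x)
  have h3 := (abs_le.1 (Real.abs_exp_sub_one_sub_id_le (x := (2 * x) ^ 2 / 2)
    (by rw [abs_of_nonneg (by positivity)]; linarith))).2
  nlinarith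

lemma sq_norm_sinh (x y : ℝ) :
    ‖Complex.sinh (x + y * Complex.I)‖ ^ 2 = Real.sinh x ^ 2 + Real.sin y ^ 2 := by
  have : Complex.sinh (x + y * Complex.I) =
      ((Real.sinh x * Real.cos y : ℝ) : ℂ) + ((Real.cosh x * Real.sin y : ℝ) : ℂ) * Complex.I := by
    rw [Complex.sinh_add, Complex.cosh_mul_I, Complex.sinh_mul_I]
    push_cast; ring
  rw [this, ← Complex.normSq_eq_norm_sq, Complex.normSq_add_mul_I]
  have h1 := Real.cosh_sq x
  have h2 := Real.sin_sq_add_cos_sq y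
  rw [mul_pow, mul_pow, h1]
  linear_combination Real.sinh x ^ 2 * h2

lemma integral_exp_centered_mul (z : ℂ) :
    (∫ u in Set.Icc (0 : ℝ) 1, Complex.exp (2 * z * (u - 1 / 2))) * z = Complex.sinh z := by
  rcases eq_or_ne z 0 with rfl | hz
  · simp
  rw [integral_Icc_eq_integral_Ioc, ← intervalIntegral.integral_of_le zero_le_one]
  have h2z : 2 * z ≠ 0 := by simp [hz]
  have : ∀ u : ℝ, Complex.exp (2 * z * (u - 1 / 2)) = Complex.exp (-z) * Complex.exp (2 * z * u) := by
    intro u; rw [← Complex.exp_add]; congr 1; ring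
  simp_rw [this]
  rw [intervalIntegral.integral_const_mul, integral_exp_mul_complex h2z, Complex.sinh]
  have e : Complex.exp (2 * z) = Complex.exp z * Complex.exp z := by
    rw [← Complex.exp_add]; congr 1; ring
  have e2 : Complex.exp (-z) * Complex.exp z = 1 := by rw [← Complex.exp_add]; simp
  simp only [Complex.ofReal_one, mul_one, Complex.ofReal_zero, mul_zero, Complex.exp_zero, e]
  field_simp
  linear_combination Complex.exp z * e2

/-- The integral is sinh z / z with z = x + iy, and |sinh z|² = sinh² x + sin² y. The sine part
yields the decay; the sinh part costs only a factor 1 + w², since x² ≤ w²/4. -/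
lemma sq_norm_integral_exp_le {w t : ℝ} (hw : w ^ 2 ≤ 1 / 2) (ht : |t| ≤ 1) (s : ℝ) :
    ‖∫ u in Set.Icc (0 : ℝ) 1, Complex.exp ((t + s * Complex.I) * w * (u - 1 / 2))‖ ^ 2
      ≤ Real.exp (w ^ 2) / (1 + w ^ 2 * s ^ 2 / 16) := by
  set x := t * w / 2
  set y := s * w / 2
  have hz : (t + s * Complex.I) * w = 2 * (x + y * Complex.I) := by
    simp only [x, y]; push_cast; ring
  have ht2 : t ^ 2 ≤ 1 := by rwa [sq_le_one_iff_abs_le_one]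
  have hx : x ^ 2 ≤ w ^ 2 / 4 := by
    have : x ^ 2 = t ^ 2 * w ^ 2 / 4 := by simp only [x]; ring
    rw [this]; nlinarith [sq_nonneg w]
  have hy : w ^ 2 * s ^ 2 / 16 = y ^ 2 / 4 := by simp only [y]; ring
  rw [hz, hy, le_div_iff₀ (by positivity)]
  have h1 := integral_exp_centered_mul (x + y * Complex.I)
  have h2 : ‖∫ u in Set.Icc (0 : ℝ) 1, Complex.exp (2 * (x + y * Complex.I) * (u - 1 / 2))‖ ^ 2 *
      (x ^ 2 + y ^ 2) = Real.sinh x ^ 2 + Real.sin y ^ 2 := by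
    rw [← sq_norm_sinh, ← h1, norm_mul, mul_pow, ← Complex.normSq_eq_norm_sq (x + y * Complex.I),
      Complex.normSq_add_mul_I]
  have h4 : 1 + w ^ 2 ≤ Real.exp (w ^ 2) := by linarith [Real.add_one_le_exp (w ^ 2)]
  rcases (by positivity : (0 : ℝ) ≤ x ^ 2 + y ^ 2).eq_or_lt with h0 | h0
  · have hx0 : x = 0 := by nlinarith [sq_nonneg x, sq_nonneg y]
    have hy0 : y = 0 := by nlinarith [sq_nonneg x, sq_nonneg y]
    simp only [hx0, hy0]
    simp
    positivity
  · rw [← mul_le_mul_iff_left₀ h0, mul_right_comm, h2]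
    have h3 := sinh_sq_le (x := x) (by linarith)
    have h5 := sin_sq_mul_le y
    have h6 : (x ^ 2 + 2 * x ^ 4) * (1 + y ^ 2 / 4) ≤ x ^ 2 + w ^ 2 * (x ^ 2 + y ^ 2) := by
      have e1 : x ^ 4 ≤ w ^ 2 / 4 * x ^ 2 := by nlinarith [sq_nonneg x]
      have e2 : x ^ 2 * y ^ 2 ≤ w ^ 2 / 4 * y ^ 2 := by nlinarith [sq_nonneg y]
      have e3 : x ^ 4 * y ^ 2 ≤ x ^ 2 * y ^ 2 := by
        have : x ^ 4 ≤ x ^ 2 := by nlinarith [sq_nonneg x]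
        nlinarith [sq_nonneg y]
      nlinarith [mul_nonneg (sq_nonneg w) (sq_nonneg x), mul_nonneg (sq_nonneg w) (sq_nonneg y)]
    have h7 : Real.sinh x ^ 2 * (1 + y ^ 2 / 4) ≤ (x ^ 2 + 2 * x ^ 4) * (1 + y ^ 2 / 4) := by gcongr
    have h8 : (1 + w ^ 2) * (x ^ 2 + y ^ 2) ≤ Real.exp (w ^ 2) * (x ^ 2 + y ^ 2) := by gcongr
    linarith

/-- Bernoulli's inequality with exponent 2w² ≤ 1 moves w² into the exponent. In a product over
normalized weights the exponents add up to 1, leaving a single integrable Cauchy profile. -/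
lemma norm_integral_exp_le_rpow {w t : ℝ} (hw : w ^ 2 ≤ 1 / 2) (ht : |t| ≤ 1) (s : ℝ) :
    ‖∫ u in Set.Icc (0 : ℝ) 1, Complex.exp ((t + s * Complex.I) * w * (u - 1 / 2))‖
      ≤ (Real.exp (1 / 2) / (1 + s ^ 2 / 32)) ^ (w ^ 2) := by
  have h0 : 0 ≤ (Real.exp (1 / 2) / (1 + s ^ 2 / 32)) ^ (w ^ 2) := by positivity
  refine (sq_le_sq₀ (norm_nonneg _) h0).1 ?_
  refine (sq_norm_integral_exp_le hw ht s).trans ?_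
  have h1 : ((Real.exp (1 / 2) / (1 + s ^ 2 / 32)) ^ (w ^ 2)) ^ 2
      = Real.exp (w ^ 2) / (1 + s ^ 2 / 32) ^ (2 * w ^ 2) := by
    rw [← Real.rpow_natCast, ← Real.rpow_mul (by positivity), Real.div_rpow (by positivity)
      (by positivity), ← Real.exp_mul]
    push_cast
    congr 2 <;> ring
  rw [h1]
  have h2 := rpow_one_add_le_one_add_mul_self (s := s ^ 2 / 32) (p := 2 * w ^ 2)
    (by linarith [sq_nonneg s]) (by positivity) (by linarith)
  have h3 : 1 + 2 * w ^ 2 * (s ^ 2 / 32) = 1 + w ^ 2 * s ^ 2 / 16 := by ring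
  rw [h3] at h2
  gcongr

end Sinc

/-! ### Bounded tilted density of linear forms on the cube -/

section Cube

/-- Lebesgue measure on the unit cube. -/
noncomputable def cubeMeasure (n : ℕ) : Measure (Fin n → ℝ) :=
  Measure.pi fun _ => volume.restrict (Set.Icc 0 1)

instance (n : ℕ) : IsFiniteMeasure (cubeMeasure n) := by
  unfold cubeMeasure; infer_instance

lemma cubeMeasure_eq (n : ℕ) : cubeMeasure n = volume.restrict (Set.Icc 0 1) := by
  rw [cubeMeasure, ← Measure.restrict_pi_pi, Set.pi_univ_Icc]; rfl

lemma integrable_cubeMeasure {n : ℕ} {f : (Fin n → ℝ) → ℝ} (hf : Continuous f) :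
    Integrable f (cubeMeasure n) := by
  rw [cubeMeasure_eq]
  exact hf.continuousOn.integrableOn_compact isCompact_Icc

lemma exp_neg_sq_div_eq_integral {ε : ℝ} (hε : 0 < ε) (y : ℝ) :
    ((Real.exp (-(y ^ 2 / (2 * ε ^ 2))) : ℝ) : ℂ) = ((ε / Real.sqrt (2 * Real.pi) : ℝ) : ℂ) *
      ∫ s : ℝ, Complex.exp (Complex.I * y * s) * Complex.exp (-((ε ^ 2 / 2 : ℝ) : ℂ) * s ^ 2) := by
  rw [fourierIntegral_gaussian (by rw [Complex.ofReal_re]; positivity)]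
  have h1 : ((Real.pi : ℂ) / ((ε ^ 2 / 2 : ℝ) : ℂ)) ^ (1 / 2 : ℂ) =
      ((Real.sqrt (2 * Real.pi) / ε : ℝ) : ℂ) := by
    rw [← Complex.ofReal_div, show (1 / 2 : ℂ) = ((1 / 2 : ℝ) : ℂ) by push_cast; rfl,
      ← Complex.ofReal_cpow (by positivity), ← Real.sqrt_eq_rpow]
    congr 1
    rw [show Real.pi / (ε ^ 2 / 2) = 2 * Real.pi / ε ^ 2 by field_simp, Real.sqrt_div (by positivity),
      Real.sqrt_sq hε.le]
  rw [h1, ← mul_assoc, ← Complex.ofReal_mul]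
  have h2 : ε / Real.sqrt (2 * Real.pi) * (Real.sqrt (2 * Real.pi) / ε) = 1 := by
    field_simp
  rw [h2, Complex.ofReal_one, one_mul, Complex.ofReal_exp]
  congr 1
  push_cast
  field_simp
  ring

lemma integral_cube_exp_linear {n : ℕ} (w : Fin n → ℝ) (z : ℂ) :
    ∫ u, Complex.exp (z * (∑ i, w i * (u i - 1 / 2) : ℝ)) ∂cubeMeasure n =
      ∏ i, ∫ u in Set.Icc (0 : ℝ) 1, Complex.exp (z * w i * (u - 1 / 2)) := by
  unfold cubeMeasure
  rw [← integral_fintype_prod_eq_prod (𝕜 := ℂ)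
    (fun i (u : ℝ) => Complex.exp (z * w i * (u - 1 / 2)))]
  congr 1; ext u
  rw [← Complex.exp_sum]
  push_cast
  rw [Finset.mul_sum]
  congr 1
  exact Finset.sum_congr rfl fun i _ => by ring

lemma norm_integral_cube_exp_le {n : ℕ} {w : Fin n → ℝ} (hw : ∀ i, w i ^ 2 ≤ 1 / 2) {t : ℝ}
    (ht : |t| ≤ 1) (s : ℝ) :
    ‖∫ u, Complex.exp ((t + s * Complex.I) * (∑ i, w i * (u i - 1 / 2) : ℝ)) ∂cubeMeasure n‖ ≤
      (Real.exp (1 / 2) / (1 + s ^ 2 / 32)) ^ (∑ i, w i ^ 2) := by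
  rw [integral_cube_exp_linear, norm_prod, Real.rpow_sum_of_pos (by positivity)]
  exact Finset.prod_le_prod (fun _ _ => norm_nonneg _) fun i _ =>
    norm_integral_exp_le_rpow (hw i) ht s

lemma integral_div_one_add_sq : ∫ s : ℝ, Real.exp (1 / 2) / (1 + s ^ 2 / 32) =
    Real.exp (1 / 2) * (Real.sqrt 32 * Real.pi) := by
  have h : ∀ s : ℝ, Real.exp (1 / 2) / (1 + s ^ 2 / 32) =
      Real.exp (1 / 2) * (1 + (s / Real.sqrt 32) ^ 2)⁻¹ := by
    intro s
    rw [div_pow, Real.sq_sqrt (by norm_num)]; rfl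
  simp_rw [h]
  rw [integral_const_mul, Measure.integral_comp_div (fun s : ℝ => (1 + s ^ 2)⁻¹),
    integral_univ_inv_one_add_sq, smul_eq_mul, abs_of_nonneg (Real.sqrt_nonneg _)]

lemma integrable_div_one_add_sq :
    Integrable fun s : ℝ => Real.exp (1 / 2) / (1 + s ^ 2 / 32) := by
  -- The integral of a non-integrable function is 0 by convention, whereas the computed value is
  -- positive.
  by_contra h
  have := integral_undef h
  rw [integral_div_one_add_sq] at this
  have h2 : 0 < Real.exp (1 / 2) * (Real.sqrt 32 * Real.pi) := by positivity
  exact h2.ne' this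

/-- Fourier inversion of the Gaussian and Fubini leave the tilted characteristic function of the
form, dominated by the Cauchy profile uniformly in ε and b. -/
lemma integral_cube_gaussian_le_of_spread {n : ℕ} {w : Fin n → ℝ} (hw : ∀ i, w i ^ 2 ≤ 1 / 2)
    (hq : ∑ i, w i ^ 2 = 1) {t : ℝ} (ht : |t| ≤ 1) (b : ℝ) {ε : ℝ} (hε : 0 < ε) :
    ∫ u, Real.exp (t * (∑ i, w i * (u i - 1 / 2)) -
        (∑ i, w i * (u i - 1 / 2) - b) ^ 2 / (2 * ε ^ 2)) ∂cubeMeasure n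
      ≤ ε / Real.sqrt (2 * Real.pi) * (Real.exp (1 / 2) * (Real.sqrt 32 * Real.pi)) := by
  set Y : (Fin n → ℝ) → ℝ := fun u => ∑ i, w i * (u i - 1 / 2) with hY
  have hYc : Continuous Y := by fun_prop
  let F : (Fin n → ℝ) → ℝ → ℂ := fun u s => Complex.exp (t * Y u) *
    (Complex.exp (Complex.I * (Y u - b : ℝ) * s) * Complex.exp (-((ε ^ 2 / 2 : ℝ) : ℂ) * s ^ 2))
  have hFint : Integrable (Function.uncurry F) ((cubeMeasure n).prod volume) := by
    have h1 : Integrable (fun u => Real.exp (t * Y u)) (cubeMeasure n) :=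
      integrable_cubeMeasure (by fun_prop)
    have h2 : Integrable fun s : ℝ => Real.exp (-(ε ^ 2 / 2) * s ^ 2) :=
      integrable_exp_neg_mul_sq (by positivity)
    refine (h1.mul_prod h2).mono' (Continuous.aestronglyMeasurable ?_) (Filter.Eventually.of_forall ?_)
    · simp only [F, Function.uncurry_def]; fun_prop
    · rintro ⟨u, s⟩
      simp only [F, Function.uncurry_apply_pair, norm_mul, Complex.norm_exp]
      rw [show (Complex.I * (Y u - b : ℝ) * s).re = 0 by simp, Real.exp_zero, one_mul]
      apply le_of_eq
      congr 2
      · simp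
      · rw [← Complex.ofReal_neg, ← Complex.ofReal_pow, ← Complex.ofReal_mul, Complex.ofReal_re]
  have h1 : ∀ u, ((Real.exp (t * Y u - (Y u - b) ^ 2 / (2 * ε ^ 2)) : ℝ) : ℂ) =
      ((ε / Real.sqrt (2 * Real.pi) : ℝ) : ℂ) * ∫ s, F u s := by
    intro u
    simp only [F]
    rw [integral_const_mul, mul_left_comm, ← exp_neg_sq_div_eq_integral hε, sub_eq_add_neg,
      Real.exp_add]
    push_cast; rfl
  have h2 : ((∫ u, Real.exp (t * Y u - (Y u - b) ^ 2 / (2 * ε ^ 2)) ∂cubeMeasure n : ℝ) : ℂ) =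
      ((ε / Real.sqrt (2 * Real.pi) : ℝ) : ℂ) * ∫ s, ∫ u, F u s ∂cubeMeasure n := by
    rw [← integral_complex_ofReal]
    simp_rw [h1]
    rw [integral_const_mul, integral_integral_swap hFint]
  have h3 : ∀ s, ‖∫ u, F u s ∂cubeMeasure n‖ ≤ Real.exp (1 / 2) / (1 + s ^ 2 / 32) := by
    intro s
    have e : ∀ u, F u s = (Complex.exp (-(Complex.I * b * s)) *
        Complex.exp (-((ε ^ 2 / 2 : ℝ) : ℂ) * s ^ 2)) *
        Complex.exp ((t + s * Complex.I) * (Y u : ℝ)) := by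
      intro u
      simp only [F]
      rw [← Complex.exp_add, ← Complex.exp_add, ← Complex.exp_add, ← Complex.exp_add]
      congr 1; push_cast; ring
    simp_rw [e]
    rw [integral_const_mul, norm_mul, norm_mul]
    have n1 : ‖Complex.exp (-(Complex.I * b * s))‖ = 1 := by
      rw [Complex.norm_exp]; simp
    have n2 : ‖Complex.exp (-((ε ^ 2 / 2 : ℝ) : ℂ) * s ^ 2)‖ ≤ 1 := by
      rw [Complex.norm_exp, ← Complex.ofReal_neg, ← Complex.ofReal_pow, ← Complex.ofReal_mul,
        Complex.ofReal_re, Real.exp_le_one_iff]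
      nlinarith [mul_nonneg (sq_nonneg ε) (sq_nonneg s)]
    have n3 := norm_integral_cube_exp_le hw ht s
    rw [hq, Real.rpow_one] at n3
    rw [n1, one_mul]
    exact (mul_le_of_le_one_left (norm_nonneg _) n2).trans n3
  have h4 := norm_integral_le_of_norm_le integrable_div_one_add_sq (Filter.Eventually.of_forall h3)
  rw [integral_div_one_add_sq] at h4
  refine (le_abs_self _).trans ?_
  change |∫ u, Real.exp (t * Y u - (Y u - b) ^ 2 / (2 * ε ^ 2)) ∂cubeMeasure n| ≤ _
  rw [← Real.norm_eq_abs, ← Complex.norm_real, h2, norm_mul, Complex.norm_real,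
    Real.norm_of_nonneg (by positivity)]
  gcongr

lemma integral_cube_exp_le {n : ℕ} {w : Fin n → ℝ} (hw : ∀ i, w i ^ 2 ≤ 1 / 2)
    (hq : ∑ i, w i ^ 2 ≤ 1) {t : ℝ} (ht : |t| ≤ 1) :
    ∫ u, Real.exp (t * (∑ i, w i * (u i - 1 / 2))) ∂cubeMeasure n ≤ Real.exp (1 / 2) := by
  have h := norm_integral_cube_exp_le hw ht 0
  have e : ∀ u : Fin n → ℝ, Complex.exp ((t + (0 : ℝ) * Complex.I) * (∑ i, w i * (u i - 1 / 2) : ℝ))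
      = ((Real.exp (t * (∑ i, w i * (u i - 1 / 2))) : ℝ) : ℂ) := by
    intro u; push_cast; simp
  simp_rw [e] at h
  rw [integral_complex_ofReal, Complex.norm_real] at h
  refine ((le_abs_self _).trans h).trans ?_
  simp only [ne_eq, OfNat.ofNat_ne_zero, not_false_eq_true, zero_pow, zero_div, add_zero, div_one]
  rw [← Real.exp_mul, Real.exp_le_exp]
  linarith

lemma integral_Icc_gaussian_le {c ε : ℝ} (hc : 1 / 2 ≤ c ^ 2) (hε : 0 < ε) {t : ℝ}
    (ht : |t| ≤ 1) (hc1 : c ^ 2 ≤ 1) (r : ℝ) :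
    ∫ x in Set.Icc (0 : ℝ) 1, Real.exp (t * (c * (x - 1 / 2)) - (c * x + r) ^ 2 / (2 * ε ^ 2)) ≤
      Real.exp (1 / 2) * (2 * Real.sqrt Real.pi * ε) := by
  have hc0 : c ≠ 0 := by rintro rfl; norm_num at hc
  have hi : Integrable fun y : ℝ => Real.exp (-(1 / (2 * ε ^ 2)) * y ^ 2) :=
    integrable_exp_neg_mul_sq (by positivity)
  have hi2 : Integrable fun x : ℝ => Real.exp (-(1 / (2 * ε ^ 2)) * (c * x + r) ^ 2) :=
    (hi.comp_add_right r).comp_mul_left' hc0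
  have hval : ∫ x : ℝ, Real.exp (-(1 / (2 * ε ^ 2)) * (c * x + r) ^ 2) =
      |c⁻¹| * (Real.sqrt (2 * Real.pi) * ε) := by
    rw [Measure.integral_comp_mul_left (fun x : ℝ => Real.exp (-(1 / (2 * ε ^ 2)) * (x + r) ^ 2)) c,
      integral_add_right_eq_self (fun x : ℝ => Real.exp (-(1 / (2 * ε ^ 2)) * x ^ 2)),
      integral_gaussian, smul_eq_mul]
    congr 1
    rw [show Real.pi / (1 / (2 * ε ^ 2)) = 2 * Real.pi * ε ^ 2 by field_simp,
      Real.sqrt_mul (by positivity), Real.sqrt_sq hε.le]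
  have hcinv : |c⁻¹| ≤ Real.sqrt 2 := by
    apply Real.le_sqrt_of_sq_le
    rw [sq_abs, inv_pow]
    exact inv_le_of_inv_le₀ (by norm_num) (by linarith)
  calc _ ≤ ∫ x in Set.Icc (0 : ℝ) 1,
        Real.exp (1 / 2) * Real.exp (-(1 / (2 * ε ^ 2)) * (c * x + r) ^ 2) := by
        refine setIntegral_mono_on ?_ (hi2.const_mul _).integrableOn measurableSet_Icc ?_
        · exact (Continuous.continuousOn (by fun_prop)).integrableOn_compact isCompact_Icc
        · intro x hx
          rw [← Real.exp_add, Real.exp_le_exp]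
          have h1 : |t * (c * (x - 1 / 2))| ≤ 1 / 2 := by
            have a1 : |c| ≤ 1 := by rwa [← sq_le_one_iff_abs_le_one]
            have a2 : |x - 1 / 2| ≤ 1 / 2 := by rw [abs_le]; constructor <;> linarith [hx.1, hx.2]
            rw [abs_mul, abs_mul]
            calc _ ≤ 1 * (1 * (1 / 2) : ℝ) := by gcongr
              _ = _ := by norm_num
          have h2 := (abs_le.1 h1).2
          have h3 : (c * x + r) ^ 2 / (2 * ε ^ 2) = 1 / (2 * ε ^ 2) * (c * x + r) ^ 2 := by ring
          rw [h3]; linarith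
    _ ≤ ∫ x : ℝ, Real.exp (1 / 2) * Real.exp (-(1 / (2 * ε ^ 2)) * (c * x + r) ^ 2) :=
        setIntegral_le_integral (hi2.const_mul _) (Filter.Eventually.of_forall fun x => by positivity)
    _ ≤ _ := by
        rw [integral_const_mul, hval]
        have : Real.sqrt (2 * Real.pi) = Real.sqrt 2 * Real.sqrt Real.pi :=
          Real.sqrt_mul (by norm_num) _
        have h2 : Real.sqrt 2 * Real.sqrt 2 = 2 := Real.mul_self_sqrt (by norm_num)
        calc _ ≤ Real.exp (1 / 2) * (Real.sqrt 2 * (Real.sqrt (2 * Real.pi) * ε)) := by gcongr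
          _ = Real.exp (1 / 2) * ((Real.sqrt 2 * Real.sqrt 2) * Real.sqrt Real.pi * ε) := by
            rw [this]; ring
          _ = _ := by rw [h2]

/-- Integrating over the heavy coordinate alone already gives O(ε), whatever the others are. These
all have squared weight below 1/2, so their exponential moment is bounded. -/
lemma integral_cube_gaussian_le_of_dominant {n : ℕ} {w : Fin n → ℝ} (i : Fin n)
    (hi : 1 / 2 < w i ^ 2) (hq : ∑ i, w i ^ 2 = 1) {t : ℝ} (ht : |t| ≤ 1) (b : ℝ) {ε : ℝ}
    (hε : 0 < ε) :
    ∫ u, Real.exp (t * (∑ i, w i * (u i - 1 / 2)) -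
        (∑ i, w i * (u i - 1 / 2) - b) ^ 2 / (2 * ε ^ 2)) ∂cubeMeasure n
      ≤ Real.exp (1 / 2) * (2 * Real.sqrt Real.pi * ε) * Real.exp (1 / 2) := by
  obtain ⟨n, rfl⟩ : ∃ m, n = m + 1 := ⟨n - 1, by have := i.2; omega⟩
  set f : (Fin (n + 1) → ℝ) → ℝ := fun u => Real.exp (t * (∑ i, w i * (u i - 1 / 2)) -
        (∑ i, w i * (u i - 1 / 2) - b) ^ 2 / (2 * ε ^ 2))
  have hfi : Integrable f (cubeMeasure (n + 1)) := integrable_cubeMeasure (by fun_prop)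
  have hmp : MeasurePreserving (MeasurableEquiv.piFinSuccAbove (fun _ => ℝ) i).symm
      ((volume.restrict (Set.Icc 0 1)).prod (cubeMeasure n)) (cubeMeasure (n + 1)) :=
    (measurePreserving_piFinSuccAbove (fun _ : Fin (n + 1) => volume.restrict (Set.Icc (0 : ℝ) 1)) i).symm
  have hfi' := (hmp.integrable_comp_emb (MeasurableEquiv.measurableEmbedding _)).2 hfi
  rw [← hmp.integral_comp']
  change ∫ z, (f ∘ (MeasurableEquiv.piFinSuccAbove (fun _ => ℝ) i).symm) z ∂_ ≤ _
  rw [integral_prod_symm _ hfi']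
  set w' : Fin n → ℝ := fun j => w (i.succAbove j)
  have hsum : w i ^ 2 + ∑ j, w' j ^ 2 = 1 := by rw [← hq, Fin.sum_univ_succAbove _ i]
  have hnn : 0 ≤ ∑ j, w' j ^ 2 := Finset.sum_nonneg fun _ _ => sq_nonneg _
  have hw' : ∀ j, w' j ^ 2 ≤ 1 / 2 := by
    intro j
    have := Finset.single_le_sum (f := fun j => w' j ^ 2) (fun i _ => sq_nonneg _) (mem_univ j)
    linarith
  have hbound : ∀ v : Fin n → ℝ, ∫ x in Set.Icc (0 : ℝ) 1,
      f ((MeasurableEquiv.piFinSuccAbove (fun _ => ℝ) i).symm (x, v)) ≤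
      Real.exp (1 / 2) * (2 * Real.sqrt Real.pi * ε) *
        Real.exp (t * ∑ j, w' j * (v j - 1 / 2)) := by
    intro v
    set R := ∑ j, w' j * (v j - 1 / 2)
    have e : ∀ x : ℝ, f ((MeasurableEquiv.piFinSuccAbove (fun _ => ℝ) i).symm (x, v)) =
        Real.exp (t * (w i * (x - 1 / 2)) -
          (w i * x + (R - b - w i * (1 / 2))) ^ 2 / (2 * ε ^ 2)) * Real.exp (t * R) := by
      intro x
      have : ∑ j, w j * ((MeasurableEquiv.piFinSuccAbove (fun _ => ℝ) i).symm (x, v) j - 1 / 2) =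
          w i * (x - 1 / 2) + R := by
        change ∑ j, w j * (Fin.insertNth (α := fun _ => ℝ) i x v j - 1 / 2) = _
        rw [Fin.sum_univ_succAbove _ i]
        simp only [Fin.insertNth_apply_same, Fin.insertNth_apply_succAbove, R, w']
      simp only [f]
      rw [this, ← Real.exp_add]
      congr 1; ring
    simp_rw [e]
    rw [integral_mul_const]
    gcongr
    exact integral_Icc_gaussian_le hi.le hε ht (by linarith) _
  calc _ ≤ ∫ v, Real.exp (1 / 2) * (2 * Real.sqrt Real.pi * ε) *
        Real.exp (t * ∑ j, w' j * (v j - 1 / 2)) ∂cubeMeasure n := by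
        refine integral_mono hfi'.integral_prod_right ?_ hbound
        exact integrable_cubeMeasure (by fun_prop)
    _ ≤ _ := by
        rw [integral_const_mul]
        gcongr
        exact integral_cube_exp_le hw' (by linarith) ht

/-- The law of a normalized linear form of independent uniform variables, exponentially tilted, has
bounded density. -/
lemma exists_integral_cube_gaussian_le : ∃ C : ℝ, 0 < C ∧ ∀ (n : ℕ) (w : Fin n → ℝ),
    ∑ i, w i = 0 → ∑ i, w i ^ 2 = 1 → ∀ t b ε : ℝ, |t| ≤ 1 → 0 < ε →
    ∫ u, Real.exp (t * (∑ i, w i * u i) - (∑ i, w i * u i - b) ^ 2 / (2 * ε ^ 2)) ∂cubeMeasure n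
      ≤ C * ε := by
  refine ⟨1 / Real.sqrt (2 * Real.pi) * (Real.exp (1 / 2) * (Real.sqrt 32 * Real.pi)) +
    Real.exp (1 / 2) * (2 * Real.sqrt Real.pi) * Real.exp (1 / 2), by positivity, ?_⟩
  intro n w hw hq t b ε ht hε
  have e : ∀ u : Fin n → ℝ, ∑ i, w i * u i = ∑ i, w i * (u i - 1 / 2) := by
    intro u
    simp only [mul_sub, Finset.sum_sub_distrib, ← Finset.sum_mul, hw]
    ring
  have e2 : ∫ u, Real.exp (t * (∑ i, w i * u i) - (∑ i, w i * u i - b) ^ 2 / (2 * ε ^ 2))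
      ∂cubeMeasure n = ∫ u, Real.exp (t * (∑ i, w i * (u i - 1 / 2)) -
        (∑ i, w i * (u i - 1 / 2) - b) ^ 2 / (2 * ε ^ 2)) ∂cubeMeasure n := by
    congr 1; ext u; rw [e u]
  rw [e2, add_mul]
  have p1 : 0 ≤ 1 / Real.sqrt (2 * Real.pi) * (Real.exp (1 / 2) * (Real.sqrt 32 * Real.pi)) * ε := by
    positivity
  have p2 : 0 ≤ Real.exp (1 / 2) * (2 * Real.sqrt Real.pi) * Real.exp (1 / 2) * ε := by positivity
  by_cases h : ∀ i, w i ^ 2 ≤ 1 / 2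
  · refine (integral_cube_gaussian_le_of_spread h hq ht b hε).trans ?_
    refine le_trans (le_of_eq ?_) (le_add_of_nonneg_right p2)
    ring
  · push Not at h
    obtain ⟨i, hi⟩ := h
    refine (integral_cube_gaussian_le_of_dominant i hi hq ht b hε).trans ?_
    refine le_trans (le_of_eq ?_) (le_add_of_nonneg_left p1)
    ring

end Cube

/-! ### Dirichlet integrals and Jensen's inequality on the gap simplex -/

section Simplex

open scoped Pointwise

/-- The corner simplex of sequences of positive reals with sum at most one. -/
def cornerSimplex (n : ℕ) : Set (Fin n → ℝ) := {g | (∀ i, 0 < g i) ∧ ∑ i, g i ≤ 1}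

lemma measurableSet_cornerSimplex (n : ℕ) : MeasurableSet (cornerSimplex n) := by
  have : cornerSimplex n = (⋂ i, {g : Fin n → ℝ | 0 < g i}) ∩ {g | ∑ i, g i ≤ 1} := by
    ext g; simp [cornerSimplex]
  rw [this]
  refine (MeasurableSet.iInter fun i => ?_).inter ?_
  · exact measurableSet_lt measurable_const (measurable_pi_apply i)
  · exact measurableSet_le (by fun_prop) measurable_const

lemma cornerSimplex_subset_Icc (n : ℕ) : cornerSimplex n ⊆ Set.Icc 0 1 := by
  rintro g ⟨h1, h2⟩
  refine ⟨fun i => (h1 i).le, fun i => ?_⟩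
  exact (Finset.single_le_sum (f := g) (fun i _ => (h1 i).le) (mem_univ i)).trans h2

lemma integrableOn_cornerSimplex {n : ℕ} {f : (Fin n → ℝ) → ℝ} (hf : Continuous f) :
    IntegrableOn f (cornerSimplex n) :=
  (hf.continuousOn.integrableOn_compact isCompact_Icc).mono_set (cornerSimplex_subset_Icc n)

lemma smul_cornerSimplex (n : ℕ) {r : ℝ} (hr : 0 < r) :
    r • cornerSimplex n = {g | (∀ i, 0 < g i) ∧ ∑ i, g i ≤ r} := by
  ext g
  rw [Set.mem_smul_set_iff_inv_smul_mem₀ hr.ne']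
  simp only [cornerSimplex, Set.mem_ofPred_eq, Pi.smul_apply, smul_eq_mul, ← Finset.mul_sum]
  refine and_congr (forall_congr' fun i => ?_) ?_
  · rw [mul_pos_iff_of_pos_left (inv_pos.2 hr)]
  · rw [inv_mul_le_iff₀ hr, mul_one]

lemma integral_pow_mul_exp_neg (k : ℕ) :
    ∫ x in Set.Ioi (0 : ℝ), x ^ k * Real.exp (-x) = (k.factorial : ℝ) := by
  rw [← Real.Gamma_nat_eq_factorial, Real.Gamma_eq_integral (by positivity)]
  refine setIntegral_congr_fun measurableSet_Ioi fun x _ => ?_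
  simp only [add_sub_cancel_right, Real.rpow_natCast]
  ring

lemma integrableOn_pow_mul_exp_neg (k : ℕ) :
    IntegrableOn (fun x : ℝ => x ^ k * Real.exp (-x)) (Set.Ioi 0) := by
  refine (Real.GammaIntegral_convergent (s := k + 1) (by positivity)).congr_fun ?_ measurableSet_Ioi
  intro x _
  simp only [add_sub_cancel_right, Real.rpow_natCast]
  ring

/-- Dirichlet's integral for monomials. -/
lemma integral_cornerSimplex_monomial {n : ℕ} (α : Fin n → ℕ) :
    ∫ g in cornerSimplex n, ∏ i, g i ^ α i =
      (∏ i, ((α i).factorial : ℝ)) / ((n + ∑ i, α i).factorial : ℝ) := by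
  set p : (Fin n → ℝ) → ℝ := fun g => ∏ i, g i ^ α i
  set d := ∑ i, α i
  set D := ∫ g in cornerSimplex n, p g
  set O : Measure (Fin n → ℝ) := Measure.pi fun _ => volume.restrict (Set.Ioi (0 : ℝ))
  have hO : O = volume.restrict (Set.univ.pi fun _ => Set.Ioi (0 : ℝ)) := by
    simp only [O]; rw [← Measure.restrict_pi_pi]; rfl
  have hOpos : ∀ᵐ g ∂O, ∀ i, 0 < g i := by
    rw [hO]
    filter_upwards [ae_restrict_mem (MeasurableSet.univ_pi fun _ => measurableSet_Ioi)] with g hg i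
    exact hg i (Set.mem_univ i)
  have hexp : ∀ g : Fin n → ℝ, p g * Real.exp (-∑ i, g i) = ∏ i, (g i ^ α i * Real.exp (-g i)) := by
    intro g
    rw [Finset.prod_mul_distrib, ← Real.exp_sum, Finset.sum_neg_distrib]
  have hint1 : Integrable (fun g => p g * Real.exp (-∑ i, g i)) O := by
    simp_rw [hexp]
    exact Integrable.fintype_prod (f := fun i (x : ℝ) => x ^ α i * Real.exp (-x))
      fun i => integrableOn_pow_mul_exp_neg (α i)
  have hval1 : ∫ g, p g * Real.exp (-∑ i, g i) ∂O = ∏ i, ((α i).factorial : ℝ) := by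
    simp_rw [hexp]
    rw [integral_fintype_prod_eq_prod (𝕜 := ℝ) (fun i (x : ℝ) => x ^ α i * Real.exp (-x))]
    exact Finset.prod_congr rfl fun i _ => integral_pow_mul_exp_neg (α i)
  -- Write exp(-∑ g) as the integral of exp(-τ) over τ ≥ ∑ g. Swapping the integrals exposes the
  -- simplex dilated by τ, so homogeneity produces a Gamma integral times the unknown D.
  let F : (Fin n → ℝ) → ℝ → ℝ := fun g τ =>
    p g * (Set.Ici (∑ i, g i)).indicator (fun τ => Real.exp (-τ)) τ
  have hFg : ∀ g : Fin n → ℝ, 0 ≤ ∑ i, g i →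
      ∫ τ in Set.Ioi 0, F g τ = p g * Real.exp (-∑ i, g i) := by
    intro g hg
    simp only [F]
    rw [integral_const_mul, setIntegral_indicator measurableSet_Ici]
    congr 1
    rw [← integral_exp_neg_Ioi]
    refine setIntegral_congr_set ?_
    rcases hg.eq_or_lt with h | h
    · rw [← h, Set.inter_eq_left.2 Set.Ioi_subset_Ici_self]
      exact Filter.EventuallyEq.rfl
    · have h' : Set.Ici (∑ i, g i) ⊆ Set.Ioi 0 := fun x hx => h.trans_le hx
      rw [Set.inter_eq_right.2 h']
      exact Ioi_ae_eq_Ici.symm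
  have hFm : Measurable (Function.uncurry F) := by
    simp only [F, Function.uncurry_def]
    refine (by fun_prop : Measurable fun q : (Fin n → ℝ) × ℝ => p q.1).mul ?_
    have : (fun q : (Fin n → ℝ) × ℝ => (Set.Ici (∑ i, q.1 i)).indicator (fun τ => Real.exp (-τ)) q.2)
        = {q : (Fin n → ℝ) × ℝ | ∑ i, q.1 i ≤ q.2}.indicator fun q => Real.exp (-q.2) := by
      ext q; simp [Set.indicator_apply]
    rw [this]
    exact Measurable.indicator (by fun_prop) (measurableSet_le (by fun_prop) (by fun_prop))
  have hFint : Integrable (Function.uncurry F) (O.prod (volume.restrict (Set.Ioi 0))) := by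
    rw [integrable_prod_iff hFm.aestronglyMeasurable]
    constructor
    · refine Filter.Eventually.of_forall fun g => ?_
      simp only [Function.uncurry_apply_pair, F]
      refine Integrable.const_mul ?_ _
      exact (integrableOn_exp_neg_Ioi 0).indicator measurableSet_Ici
    · refine hint1.congr ?_
      filter_upwards [hOpos] with g hg
      rw [← hFg g (Finset.sum_nonneg fun i _ => (hg i).le)]
      refine setIntegral_congr_fun measurableSet_Ioi fun τ _ => ?_
      simp only [Function.uncurry_apply_pair, F]
      rw [Real.norm_of_nonneg]
      exact mul_nonneg (Finset.prod_nonneg fun i _ => pow_nonneg (hg i).le _)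
        (Set.indicator_nonneg (fun _ _ => (Real.exp_pos _).le) _)
  have hswap := integral_integral_swap hFint
  have hleft : ∫ g, (∫ τ in Set.Ioi 0, F g τ) ∂O = ∏ i, ((α i).factorial : ℝ) := by
    rw [← hval1]
    refine integral_congr_ae ?_
    filter_upwards [hOpos] with g hg
    exact hFg g (Finset.sum_nonneg fun i _ => (hg i).le)
  have hright : ∀ τ ∈ Set.Ioi (0 : ℝ), ∫ g, F g τ ∂O = τ ^ (n + d) * Real.exp (-τ) * D := by
    intro τ hτ
    have hτ' : 0 < τ := hτ
    have e1 : ∀ g, F g τ = Real.exp (-τ) * {g : Fin n → ℝ | ∑ i, g i ≤ τ}.indicator p g := by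
      intro g
      simp only [F, Set.indicator_apply, Set.mem_Ici, Set.mem_ofPred_eq]
      split_ifs <;> ring
    simp_rw [e1]
    rw [integral_const_mul, hO, setIntegral_indicator (measurableSet_le (by fun_prop) measurable_const)]
    have e2 : (Set.univ.pi fun _ => Set.Ioi (0 : ℝ)) ∩ {g : Fin n → ℝ | ∑ i, g i ≤ τ} =
        τ • cornerSimplex n := by
      rw [smul_cornerSimplex n hτ']; ext g; simp
    rw [e2]
    have e3 := Measure.setIntegral_comp_smul volume p (cornerSimplex n) hτ'.ne'
    have e4 : ∀ g, p (τ • g) = τ ^ d * p g := by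
      intro g
      simp only [p, Pi.smul_apply, smul_eq_mul, mul_pow, Finset.prod_mul_distrib,
        Finset.prod_pow_eq_pow_sum, d]
    simp_rw [e4] at e3
    rw [integral_const_mul, smul_eq_mul, Module.finrank_fin_fun, abs_of_nonneg (by positivity)] at e3
    have e5 : ∫ g in τ • cornerSimplex n, p g = τ ^ n * (τ ^ d * D) := by
      rw [e3, ← mul_assoc, mul_inv_cancel₀ (by positivity), one_mul]
    rw [e5, pow_add]; ring
  rw [hleft, setIntegral_congr_fun measurableSet_Ioi hright, integral_mul_const,
    integral_pow_mul_exp_neg] at hswap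
  rw [eq_div_iff (by positivity), mul_comm, hswap]

lemma integral_cornerSimplex_const (n : ℕ) (a : ℝ) :
    ∫ _g in cornerSimplex n, a = a / (n.factorial : ℝ) := by
  have h := integral_cornerSimplex_monomial (n := n) 0
  simp only [Pi.zero_apply, pow_zero, Finset.prod_const_one, Nat.factorial_zero, Nat.cast_one,
    Finset.sum_const_zero, add_zero] at h
  rw [show (fun _ : Fin n → ℝ => a) = fun _ => a * 1 by simp, integral_const_mul, h]
  ring

lemma integral_cornerSimplex_linear {n : ℕ} (c : Fin n → ℝ) :
    ∫ g in cornerSimplex n, ∑ i, c i * g i = (∑ i, c i) / ((n + 1).factorial : ℝ) := by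
  rw [integral_finsetSum _ fun i _ => integrableOn_cornerSimplex (by fun_prop), Finset.sum_div]
  refine Finset.sum_congr rfl fun i _ => ?_
  rw [integral_const_mul]
  have h := integral_cornerSimplex_monomial (n := n) (Pi.single i 1)
  have e : ∀ g : Fin n → ℝ, ∏ j, g j ^ (Pi.single i 1 : Fin n → ℕ) j = g i := by
    intro g
    rw [Finset.prod_eq_single i (fun j _ hj => by simp [Pi.single_eq_of_ne hj]) (by simp)]
    simp
  have e2 : ∏ j, (((Pi.single i 1 : Fin n → ℕ) j).factorial : ℝ) = 1 := by
    refine Finset.prod_eq_one fun j _ => ?_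
    by_cases hj : j = i
    · subst hj; simp
    · simp [Pi.single_eq_of_ne hj]
  simp_rw [e] at h
  rw [h, e2, Finset.sum_pi_single' i 1 Finset.univ, if_pos (mem_univ i)]
  ring

lemma integral_cornerSimplex_mul {n : ℕ} (i j : Fin n) :
    ∫ g in cornerSimplex n, g i * g j = (1 + if i = j then 1 else 0) / ((n + 2).factorial : ℝ) := by
  have h := integral_cornerSimplex_monomial (n := n) (Pi.single i 1 + Pi.single j 1)
  have e1 : ∀ (k : Fin n) (g : Fin n → ℝ), ∏ j, g j ^ (Pi.single k 1 : Fin n → ℕ) j = g k := by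
    intro k g
    rw [Finset.prod_eq_single k (fun j _ hj => by simp [Pi.single_eq_of_ne hj]) (by simp)]
    simp
  have e : ∀ g : Fin n → ℝ, ∏ k, g k ^ (Pi.single i 1 + Pi.single j 1 : Fin n → ℕ) k = g i * g j := by
    intro g
    simp only [Pi.add_apply, pow_add, Finset.prod_mul_distrib, e1]
  have e2 : ∏ k, (((Pi.single i 1 + Pi.single j 1 : Fin n → ℕ) k).factorial : ℝ) =
      1 + if i = j then 1 else 0 := by
    rw [Finset.prod_eq_single i]
    · by_cases hij : i = j
      · subst hij; simp; norm_num
      · simp [hij]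
    · intro k _ hk
      by_cases hkj : k = j
      · subst hkj; simp [Pi.single_eq_of_ne hk]
      · simp [Pi.single_eq_of_ne hk, Pi.single_eq_of_ne hkj]
    · simp
  have e3 : ∑ k, (Pi.single i 1 + Pi.single j 1 : Fin n → ℕ) k = 2 := by
    simp [Finset.sum_add_distrib]
  simp_rw [e] at h
  rw [h, e2, e3]

lemma integral_cornerSimplex_linear_sq {n : ℕ} (c : Fin n → ℝ) :
    ∫ g in cornerSimplex n, (∑ i, c i * g i) ^ 2 =
      ((∑ i, c i) ^ 2 + ∑ i, c i ^ 2) / ((n + 2).factorial : ℝ) := by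
  have e : ∀ g : Fin n → ℝ, (∑ i, c i * g i) ^ 2 = ∑ i, ∑ j, (c i * c j) * (g i * g j) := by
    intro g
    rw [sq, Finset.sum_mul_sum]
    exact Finset.sum_congr rfl fun i _ => Finset.sum_congr rfl fun j _ => by ring
  simp_rw [e]
  rw [integral_finsetSum _ fun i _ => integrableOn_cornerSimplex (by fun_prop)]
  have e2 : ∀ i, ∫ g in cornerSimplex n, ∑ j, (c i * c j) * (g i * g j) =
      (c i * ∑ j, c j + c i ^ 2) / ((n + 2).factorial : ℝ) := by
    intro i
    rw [integral_finsetSum _ fun i _ => integrableOn_cornerSimplex (by fun_prop)]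
    simp_rw [integral_const_mul, integral_cornerSimplex_mul, ← mul_div_assoc]
    rw [← Finset.sum_div]
    congr 1
    simp [mul_add, Finset.sum_add_distrib, Finset.mul_sum, sq]
  simp_rw [e2]
  rw [← Finset.sum_div, Finset.sum_add_distrib, ← Finset.sum_mul, sq (∑ i, c i)]

/-- Jensen's inequality for the exponential of a quadratic function of a linear form. -/
lemma le_integral_cornerSimplex_exp {n : ℕ} (c : Fin n → ℝ) (t b ε : ℝ) :
    Real.exp (t * ((∑ i, c i) / (n + 1)) -
        (((∑ i, c i) ^ 2 + ∑ i, c i ^ 2) / ((n + 1) * (n + 2)) - 2 * b * ((∑ i, c i) / (n + 1)) +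
          b ^ 2) / (2 * ε ^ 2)) / (n.factorial : ℝ) ≤
      ∫ g in cornerSimplex n,
        Real.exp (t * (∑ i, c i * g i) - (∑ i, c i * g i - b) ^ 2 / (2 * ε ^ 2)) := by
  set m := t * ((∑ i, c i) / (n + 1)) -
        (((∑ i, c i) ^ 2 + ∑ i, c i ^ 2) / ((n + 1) * (n + 2)) - 2 * b * ((∑ i, c i) / (n + 1)) +
          b ^ 2) / (2 * ε ^ 2) with hm
  set L : (Fin n → ℝ) → ℝ := fun g => ∑ i, c i * g i
  have hL : Continuous L := by fun_prop
  -- The integrand is the tangent line of exp at m, evaluated at the quadratic exponent. As m is the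
  -- mean of that exponent over the simplex, the linear term integrates to zero.
  have h1 : ∫ g in cornerSimplex n, Real.exp m * (1 - m - b ^ 2 / (2 * ε ^ 2) +
      (t + 2 * b / (2 * ε ^ 2)) * L g - 1 / (2 * ε ^ 2) * L g ^ 2) =
      Real.exp m / (n.factorial : ℝ) := by
    rw [integral_const_mul, integral_sub (integrableOn_cornerSimplex (by fun_prop))
      (integrableOn_cornerSimplex (by fun_prop)), integral_add (integrableOn_cornerSimplex (by fun_prop))
      (integrableOn_cornerSimplex (by fun_prop)), integral_cornerSimplex_const, integral_const_mul,
      integral_const_mul, integral_cornerSimplex_linear, integral_cornerSimplex_linear_sq,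
      show n + 2 = (n + 1) + 1 from rfl, Nat.factorial_succ (n + 1), Nat.factorial_succ n]
    rw [div_eq_mul_inv (Real.exp m)]
    congr 1
    have hf : (n.factorial : ℝ) ≠ 0 := by positivity
    have h1 : (n : ℝ) + 1 ≠ 0 := by positivity
    have h2 : (n : ℝ) + 2 ≠ 0 := by positivity
    push_cast
    rw [show (n : ℝ) + 1 + 1 = n + 2 by ring, hm]
    -- No condition is imposed on ε, so q = 0 occurs; there division yields 0 and the identity still
    -- holds.
    generalize 2 * ε ^ 2 = q
    rcases eq_or_ne q 0 with rfl | hq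
    · simp; field_simp; ring
    · field_simp; ring
  rw [← h1]
  refine setIntegral_mono_on (integrableOn_cornerSimplex (by fun_prop))
    (integrableOn_cornerSimplex (by fun_prop)) (measurableSet_cornerSimplex n) fun g _ => ?_
  have h2 := Real.add_one_le_exp (t * L g - (L g - b) ^ 2 / (2 * ε ^ 2) - m)
  rw [Real.exp_sub, le_div_iff₀ (Real.exp_pos m)] at h2
  refine le_trans (le_of_eq ?_) h2
  rw [mul_comm]
  congr 1
  ring

end Simplex

/-! ### Decomposition of the cube by the order of the coordinates -/

section Chambers

/-- The sequence of cumulative sums. -/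
noncomputable def cumulativeSum {n : ℕ} (g : Fin n → ℝ) : Fin n → ℝ :=
  fun j => ∑ i, if i ≤ j then g i else 0

lemma continuous_cumulativeSum (n : ℕ) : Continuous (cumulativeSum (n := n)) := by
  unfold cumulativeSum
  refine continuous_pi fun j => continuous_finsetSum _ fun i _ => ?_
  split_ifs <;> fun_prop

lemma cumulativeSum_sub {n : ℕ} (g : Fin n → ℝ) {i j : Fin n} (hij : i ≤ j) :
    cumulativeSum g j - cumulativeSum g i = ∑ k ∈ Finset.Ioc i j, g k := by
  simp only [cumulativeSum, ← Finset.sum_filter]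
  rw [sub_eq_iff_eq_add, ← Finset.sum_union]
  · congr 1; ext k; simp only [mem_filter, mem_univ, true_and, mem_union, mem_Ioc]
    constructor
    · intro h
      rcases le_or_gt k i with h' | h'
      · exact Or.inr h'
      · exact Or.inl ⟨h', h⟩
    · rintro (h | h)
      · exact h.2
      · exact h.trans hij
  · rw [Finset.disjoint_left]
    intro k hk
    simp only [mem_Ioc, mem_filter, mem_univ, true_and] at hk ⊢
    exact not_le.2 hk.1

lemma strictMono_cumulativeSum {n : ℕ} {g : Fin n → ℝ} (hg : ∀ i, 0 < g i) :
    StrictMono (cumulativeSum g) := by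
  intro i j hij
  rw [← sub_pos, cumulativeSum_sub g hij.le]
  exact Finset.sum_pos (fun k _ => hg k) ⟨j, by simpa using hij⟩

lemma cumulativeSum_eq_toLin' {n : ℕ} : (cumulativeSum (n := n)) =
    Matrix.toLin' (Matrix.of fun j i : Fin n => if i ≤ j then (1 : ℝ) else 0) := by
  ext g j
  simp [cumulativeSum, Matrix.toLin'_apply, Matrix.mulVec, dotProduct]

lemma det_cumulativeSum (n : ℕ) :
    (Matrix.of fun j i : Fin n => if i ≤ j then (1 : ℝ) else 0).det = 1 := by
  rw [Matrix.det_of_isLowerTriangular]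
  · simp
  · intro i j hij
    have : i < j := hij
    simp [not_le.2 this]

lemma measurePreserving_cumulativeSum (n : ℕ) :
    MeasurePreserving (cumulativeSum (n := n)) volume volume := by
  refine ⟨(continuous_cumulativeSum n).measurable, ?_⟩
  rw [cumulativeSum_eq_toLin', Real.map_matrix_volume_pi_eq_smul_volume_pi]
  · simp [det_cumulativeSum]
  · simp [det_cumulativeSum]

lemma injective_cumulativeSum (n : ℕ) : Function.Injective (cumulativeSum (n := n)) := by
  rw [cumulativeSum_eq_toLin', ← LinearMap.ker_eq_bot]
  apply LinearMap.ker_eq_bot_of_injective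
  rw [Matrix.toLin'_apply']
  exact Matrix.mulVec_injective_of_isUnit ((Matrix.isUnit_iff_isUnit_det _).2 (by simp [det_cumulativeSum]))

/-- The parametrization by gaps of the sequences which are increasing after relabelling by `σ`. -/
noncomputable def chamberMap {n : ℕ} (σ : Equiv.Perm (Fin n)) (g : Fin n → ℝ) : Fin n → ℝ :=
  cumulativeSum g ∘ σ.symm

lemma measurePreserving_chamberMap {n : ℕ} (σ : Equiv.Perm (Fin n)) :
    MeasurePreserving (chamberMap σ) volume volume := by
  have h := (volume_measurePreserving_piCongrLeft (fun _ : Fin n => ℝ) σ).comp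
    (measurePreserving_cumulativeSum n)
  convert h using 1
  ext g i
  obtain ⟨j, rfl⟩ := σ.surjective i
  simp [chamberMap, MeasurableEquiv.coe_piCongrLeft]

lemma measurableEmbedding_chamberMap {n : ℕ} (σ : Equiv.Perm (Fin n)) :
    MeasurableEmbedding (chamberMap σ) := by
  refine (measurePreserving_chamberMap σ).measurable.measurableEmbedding fun g g' h => ?_
  apply injective_cumulativeSum n
  exact σ.symm.surjective.injective_comp_right h

lemma disjoint_chamberMap_image {n : ℕ} {σ τ : Equiv.Perm (Fin n)} (hστ : σ ≠ τ) :
    Disjoint (chamberMap σ '' cornerSimplex n) (chamberMap τ '' cornerSimplex n) := by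
  rw [Set.disjoint_left]
  rintro _ ⟨g, hg, rfl⟩ ⟨g', hg', h⟩
  apply hστ
  have h1 := strictMono_cumulativeSum hg.1
  have h2 := strictMono_cumulativeSum hg'.1
  have h3 : ∀ i, cumulativeSum g' (τ.symm (σ i)) = cumulativeSum g i := by
    intro i
    have := congrFun h (σ i)
    simpa [chamberMap] using this
  have h4 : StrictMono fun i => τ.symm (σ i) := by
    intro i j hij
    rw [← h2.lt_iff_lt, h3, h3]
    exact h1 hij
  have h5 : (fun i => τ.symm (σ i)) = id :=
    StrictMono.range_inj h4 strictMono_id |>.1 (by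
      rw [Set.range_id]; exact (σ.trans τ.symm).surjective.range_eq)
  ext i
  have := congrFun h5 i
  simp only [id, Equiv.symm_apply_eq] at this
  rw [this]

lemma chamberMap_image_subset {n : ℕ} (σ : Equiv.Perm (Fin n)) :
    chamberMap σ '' cornerSimplex n ⊆ Set.Icc 0 1 := by
  rintro _ ⟨g, hg, rfl⟩
  constructor
  · intro i
    change 0 ≤ ∑ k, if k ≤ σ.symm i then g k else 0
    refine Finset.sum_nonneg fun k _ => ?_
    split_ifs
    · exact (hg.1 k).le
    · exact le_rfl
  · intro i
    change (∑ k, if k ≤ σ.symm i then g k else 0) ≤ 1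
    refine le_trans (Finset.sum_le_sum fun k _ => ?_) hg.2
    split_ifs
    · exact le_rfl
    · exact (hg.1 k).le

/-- The gap g_m enters every coordinate from rank m on, so its coefficient is a tail sum of the
permuted weights, which is -S_m because the total is zero. -/
lemma sum_mul_chamberMap {n : ℕ} (w : Fin n → ℝ) (hw : ∑ i, w i = 0) (σ : Equiv.Perm (Fin n))
    (g : Fin n → ℝ) :
    ∑ i, w i * chamberMap σ g i = ∑ m : Fin n, -partialSum (w ∘ σ) m * g m := by
  have h1 : ∑ i, w i * chamberMap σ g i = ∑ j, (w ∘ σ) j * cumulativeSum g j := by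
    rw [← Equiv.sum_comp σ]
    simp [chamberMap]
  rw [h1]
  simp only [cumulativeSum, Finset.mul_sum]
  rw [Finset.sum_comm]
  refine Finset.sum_congr rfl fun m _ => ?_
  have h2 : ∑ j, (w ∘ σ) j * (if m ≤ j then g m else 0) + partialSum (w ∘ σ) m * g m = 0 := by
    rw [partialSum, Finset.sum_mul, ← Finset.sum_add_distrib]
    have : ∀ j, (w ∘ σ) j * (if m ≤ j then g m else 0) +
        (if (j : ℕ) < (m : ℕ) then (w ∘ σ) j else 0) * g m = (w ∘ σ) j * g m := by
      intro j
      by_cases h : m ≤ j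
      · have h' : ¬ (j : ℕ) < (m : ℕ) := not_lt.2 h
        simp [h, h']
      · have h' : (j : ℕ) < (m : ℕ) := not_le.1 h
        simp [h, h']
    rw [Finset.sum_congr rfl fun j _ => this j, ← Finset.sum_mul, sum_comp_perm, hw, zero_mul]
  linarith

/-- For an upper bound with f ≥ 0 it suffices that the chambers are disjoint and lie in the cube;
that they fill it up to a null set is not needed. -/
lemma sum_integral_chamber_le {n : ℕ} {f : (Fin n → ℝ) → ℝ} (hf : Continuous f) (hf0 : ∀ u, 0 ≤ f u) :
    ∑ σ : Equiv.Perm (Fin n), ∫ g in cornerSimplex n, f (chamberMap σ g) ≤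
      ∫ u, f u ∂cubeMeasure n := by
  have hint : IntegrableOn f (Set.Icc 0 1) := hf.continuousOn.integrableOn_compact isCompact_Icc
  have h1 : ∀ σ : Equiv.Perm (Fin n), ∫ g in cornerSimplex n, f (chamberMap σ g) =
      ∫ u in chamberMap σ '' cornerSimplex n, f u := fun σ =>
    ((measurePreserving_chamberMap σ).setIntegral_image_emb (measurableEmbedding_chamberMap σ) _ _).symm
  simp_rw [h1]
  rw [← integral_biUnion_finset Finset.univ
    (fun σ _ => (measurableEmbedding_chamberMap σ).measurableSet_image.2 (measurableSet_cornerSimplex n))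
    (fun σ _ τ _ h => disjoint_chamberMap_image h)
    (fun σ _ => hint.mono_set (chamberMap_image_subset σ)), cubeMeasure_eq]
  refine setIntegral_mono_set hint (Filter.Eventually.of_forall hf0) (Filter.Eventually.of_forall ?_)
  exact Set.iUnion₂_subset fun σ _ => chamberMap_image_subset σ

lemma sum_partialSum_fin {n : ℕ} (v : Fin n → ℝ) (hv : ∑ i, v i = 0) :
    ∑ m : Fin n, -partialSum v m = firstMoment v := by
  rw [firstMoment_eq_neg_sum_partialSum v hv, Finset.sum_neg_distrib,
    Fin.sum_univ_eq_sum_range (fun k => partialSum v k) n]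

/-- Each chamber has volume 1/n!, the probability of its permutation, so Jensen's inequality on
every chamber sums to an average over permutations. -/
lemma expect_exp_le_integral_cube {n : ℕ} (w : Fin n → ℝ) (hw : ∑ i, w i = 0) (t b ε : ℝ) :
    𝔼 σ : Equiv.Perm (Fin n), Real.exp (t * (firstMoment (w ∘ σ) / (n + 1)) -
        ((firstMoment (w ∘ σ) ^ 2 + ∑ k ∈ range n, partialSum (w ∘ σ) k ^ 2) / ((n + 1) * (n + 2)) -
          2 * b * (firstMoment (w ∘ σ) / (n + 1)) + b ^ 2) / (2 * ε ^ 2)) ≤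
      ∫ u, Real.exp (t * (∑ i, w i * u i) - (∑ i, w i * u i - b) ^ 2 / (2 * ε ^ 2))
        ∂cubeMeasure n := by
  refine le_trans ?_ (sum_integral_chamber_le (by fun_prop) fun u => (Real.exp_pos _).le)
  rw [Fintype.expect_eq_sum_div_card, Fintype.card_perm, Fintype.card_fin, Finset.sum_div]
  refine Finset.sum_le_sum fun σ _ => ?_
  have h := le_integral_cornerSimplex_exp (fun m : Fin n => -partialSum (w ∘ σ) m) t b ε
  simp only [sum_partialSum_fin (w ∘ σ) (by rw [sum_comp_perm, hw]), neg_sq,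
    Fin.sum_univ_eq_sum_range (fun k => partialSum (w ∘ σ) k ^ 2) n] at h
  simpa only [sum_mul_chamberMap w hw σ] using h

end Chambers

/-! ### Removing the variance weight by induction on the length -/

section Main

lemma exists_expect_window_mul_exp_le : ∃ C : ℝ, 0 < C ∧ ∀ (n : ℕ) (w : Fin n → ℝ), 0 < n →
    ∑ i, w i = 0 → ∑ i, w i ^ 2 = 1 → ∀ t a h : ℝ, |t| ≤ 1 / 2 → Real.sqrt n ≤ h →
    𝔼 σ : Equiv.Perm (Fin n), window a h (firstMoment (w ∘ σ)) *
      Real.exp (t / n * firstMoment (w ∘ σ)) *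
        Real.exp (-((∑ k ∈ range n, partialSum (w ∘ σ) k ^ 2) / (2 * n))) ≤ C * (h / n) := by
  obtain ⟨C, hC, hC'⟩ := exists_integral_cube_gaussian_le
  refine ⟨Real.exp (1 / 2) * C, by positivity, ?_⟩
  intro n w hn hw hq t a h ht hh
  have hnr : (0 : ℝ) < n := by exact_mod_cast hn
  have hn1 : (1 : ℝ) ≤ n := by exact_mod_cast hn
  have hh0 : 0 < h := (Real.sqrt_pos.2 hnr).trans_le hh
  have hhn : (n : ℝ) ≤ h ^ 2 := by
    rw [← Real.sq_sqrt hnr.le]; gcongr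
  have ht' : |t * (n + 1) / n| ≤ 1 := by
    rw [abs_div, abs_mul, abs_of_pos hnr, abs_of_pos (by positivity : (0 : ℝ) < n + 1),
      div_le_one hnr]
    nlinarith
  -- The conditional mean of the form is W/(n+1), so the tilt and the centre are rescaled by n + 1;
  -- since |t| ≤ 1/2, the new tilt is still at most 1.
  have h1 := (expect_exp_le_integral_cube w hw (t * (n + 1) / n) (a / (n + 1)) (h / n)).trans
    (hC' n w hw hq _ (a / (n + 1)) (h / n) ht' (by positivity))
  rw [mul_assoc]
  refine le_trans ?_ (mul_le_mul_of_nonneg_left h1 (Real.exp_pos _).le)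
  rw [Finset.mul_expect]
  refine Finset.expect_le_expect fun σ _ => ?_
  set W := firstMoment (w ∘ σ)
  set Q := ∑ k ∈ range n, partialSum (w ∘ σ) k ^ 2
  have hQ : 0 ≤ Q := Finset.sum_nonneg fun _ _ => sq_nonneg _
  unfold window
  split_ifs with hwin
  · rw [one_mul, ← Real.exp_add, ← Real.exp_add, Real.exp_le_exp]
    have e1 : t * (n + 1) / n * (W / (n + 1)) = t / n * W := by field_simp
    have e2 : (W ^ 2 + Q) / ((n + 1) * (n + 2)) - 2 * (a / (n + 1)) * (W / (n + 1)) +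
        (a / (n + 1)) ^ 2 ≤ h ^ 2 / n ^ 2 + Q / n ^ 2 := by
      have f1 : (W ^ 2 + Q) / ((n + 1) * (n + 2)) ≤ W ^ 2 / (n + 1) ^ 2 + Q / n ^ 2 := by
        rw [add_div]
        gcongr <;> nlinarith
      have f2 : (W - a) ^ 2 / (n + 1) ^ 2 ≤ h ^ 2 / n ^ 2 := by
        have : (W - a) ^ 2 ≤ h ^ 2 := by rw [← sq_abs]; gcongr
        gcongr
        linarith
      have f3 : (W - a) ^ 2 / ((n : ℝ) + 1) ^ 2 = W ^ 2 / (n + 1) ^ 2 -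
          2 * (a / (n + 1)) * (W / (n + 1)) + (a / (n + 1)) ^ 2 := by
        field_simp; ring
      linarith
    -- Here h ≥ √n is essential: the smoothing width h/n makes the variance cost Q/(2h²) ≤ Q/(2n).
    have e3 : (h ^ 2 / (n : ℝ) ^ 2 + Q / n ^ 2) / (2 * (h / n) ^ 2) ≤ 1 / 2 + Q / (2 * n) := by
      have : (h ^ 2 / (n : ℝ) ^ 2 + Q / n ^ 2) / (2 * (h / n) ^ 2) = 1 / 2 + Q / (2 * h ^ 2) := by
        field_simp
      rw [this]
      gcongr
    have e4 : ((W ^ 2 + Q) / ((n + 1) * (n + 2)) - 2 * (a / (n + 1)) * (W / (n + 1)) +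
        (a / (n + 1)) ^ 2) / (2 * (h / n) ^ 2) ≤ 1 / 2 + Q / (2 * n) :=
      (div_le_div_of_nonneg_right e2 (by positivity)).trans e3
    rw [e1]
    linarith
  · rw [zero_mul, zero_mul]; positivity

lemma one_le_exp_mul_exp_neg_add_div {K v : ℝ} (hK : 0 < K) (hv : 0 ≤ v) :
    1 ≤ Real.exp K * Real.exp (-v) + v / K := by
  rcases le_total v K with h | h
  · have h1 : 1 ≤ Real.exp K * Real.exp (-v) := by
      rw [← Real.exp_add]; exact Real.one_le_exp (by linarith)
    have : 0 ≤ v / K := by positivity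
    linarith
  · have h1 : 1 ≤ v / K := (one_le_div hK).2 h
    have : 0 < Real.exp K * Real.exp (-v) := by positivity
    linarith

/-- A uniform tilted concentration bound for weighted sums of random permutations. -/
theorem exists_forall_concentrated : ∃ P : ℝ, 0 < P ∧ ∀ n, Concentrated P n := by
  obtain ⟨C, hC, hC'⟩ := exists_expect_window_mul_exp_le
  -- K is the factor lost in the block estimate, so the correction term equals half of P h/n. The
  -- choice of P makes the main term at most the other half, and P ≥ e serves the case where both
  -- blocks have small variance.
  set K := 4096 * Real.exp 1 with hKdef
  have hK : 0 < K := by positivity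
  set P := Real.exp 1 + 2 * (Real.exp K * C) with hPdef
  have hPe : Real.exp 1 ≤ P := by
    have : 0 ≤ 2 * (Real.exp K * C) := by positivity
    linarith
  have hP0 : 0 < P := (Real.exp_pos 1).trans_le hPe
  refine ⟨P, hP0, fun n => ?_⟩
  induction n using Nat.strong_induction_on with
  | _ n ih =>
  intro w hw hq t a h ht hh
  have hn : 0 < n := by
    rcases Nat.eq_zero_or_pos n with rfl | hn
    · simp at hq
    · exact hn
  have hnr : (0 : ℝ) < n := by exact_mod_cast hn
  have hh0 : 0 ≤ h := (Real.sqrt_nonneg _).trans hh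
  have h1 := hC' n w hn hw hq t a h ht hh
  have h2 : ∀ k ∈ range n, 𝔼 σ : Equiv.Perm (Fin n), partialSum (w ∘ σ) k ^ 2 *
      (window a h (firstMoment (w ∘ σ)) * Real.exp (t / n * firstMoment (w ∘ σ))) ≤
        K * P * (h / n) := by
    intro k hk
    have hkn := Finset.mem_range.1 hk
    rcases Nat.eq_zero_or_pos k with rfl | hk0
    · simp only [partialSum_zero, ne_eq, OfNat.ofNat_ne_zero, not_false_eq_true, zero_pow, zero_mul,
        Finset.expect_const_zero]
      positivity
    · exact expect_sq_partialSum_mul_window_le hk0 hkn hPe (ih k hkn) (ih (n - k) (by omega)) w hw hq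
        a ht hh
  have h3 : ∀ σ : Equiv.Perm (Fin n), window a h (firstMoment (w ∘ σ)) *
      Real.exp (t / n * firstMoment (w ∘ σ)) ≤
      Real.exp K * (window a h (firstMoment (w ∘ σ)) * Real.exp (t / n * firstMoment (w ∘ σ)) *
        Real.exp (-((∑ k ∈ range n, partialSum (w ∘ σ) k ^ 2) / (2 * n)))) +
      1 / (2 * n * K) * ∑ k ∈ range n, partialSum (w ∘ σ) k ^ 2 *
        (window a h (firstMoment (w ∘ σ)) * Real.exp (t / n * firstMoment (w ∘ σ))) := by
    intro σ
    rw [← Finset.sum_mul]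
    have hG : 0 ≤ window a h (firstMoment (w ∘ σ)) * Real.exp (t / n * firstMoment (w ∘ σ)) :=
      mul_nonneg (window_nonneg _ _ _) (Real.exp_pos _).le
    set G := window a h (firstMoment (w ∘ σ)) * Real.exp (t / n * firstMoment (w ∘ σ))
    set Q := ∑ k ∈ range n, partialSum (w ∘ σ) k ^ 2
    have hQ : 0 ≤ Q := Finset.sum_nonneg fun _ _ => sq_nonneg _
    have := mul_le_mul_of_nonneg_left
      (one_le_exp_mul_exp_neg_add_div hK (v := Q / (2 * n)) (by positivity)) hG
    rw [mul_one] at this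
    refine this.trans (le_of_eq ?_)
    field_simp
  refine (Finset.expect_le_expect fun σ _ => h3 σ).trans ?_
  rw [Finset.expect_add_distrib, ← Finset.mul_expect, ← Finset.mul_expect, Finset.expect_sum_comm]
  have h4 := Finset.sum_le_sum h2
  rw [Finset.sum_const, card_range, nsmul_eq_mul] at h4
  have h5 : 1 / (2 * n * K) * ((n : ℝ) * (K * P * (h / n))) = P * (h / n) / 2 := by
    field_simp
  have h6 := mul_le_mul_of_nonneg_left h4 (by positivity : 0 ≤ 1 / (2 * n * K))
  rw [h5] at h6
  have h7 := mul_le_mul_of_nonneg_left h1 (Real.exp_pos K).le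
  have h8 : Real.exp K * (C * (h / n)) ≤ P * (h / n) / 2 := by
    have : 0 ≤ Real.exp 1 * (h / n) := by positivity
    rw [hPdef]; nlinarith
  linarith

end Main

/-! ### From averages to probabilities -/

open Classical in
lemma uniformOfFintype_toOuterMeasure_eq {α : Type*} [Fintype α] [Nonempty α] (p : α → Prop) :
    (PMF.uniformOfFintype α).toOuterMeasure {x | p x} =
      ENNReal.ofReal (𝔼 x, if p x then (1 : ℝ) else 0) := by
  rw [PMF.toOuterMeasure_uniformOfFintype_apply, Fintype.expect_eq_sum_div_card, Finset.sum_boole,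
    ENNReal.ofReal_div_of_pos (by exact_mod_cast Fintype.card_pos), ENNReal.ofReal_natCast,
    ENNReal.ofReal_natCast, Fintype.card_subtype]
  rfl

theorem mainTheorem7 :
    ∃ C : ℝ, 0 < C ∧ ∃ c : ℝ, 0 < c ∧
      ∀ n : ℕ, 2 ≤ n → ∀ w : Fin n → ℝ, ∑ i, w i = 0 → ∑ i, w i ^ 2 = 1 → ∀ L : ℝ,
        (PMF.uniformOfFintype (Equiv.Perm (Fin n))).toOuterMeasure
            {σ | |(∑ i, w i * (((σ i : ℕ) : ℝ) + 1)) - L * (n : ℝ)| ≤ Real.sqrt (n : ℝ)}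
          ≤ ENNReal.ofReal (C / Real.sqrt (n : ℝ) * Real.exp (-(c * |L|))) := by
  obtain ⟨P, hP, hconc⟩ := exists_forall_concentrated
  refine ⟨Real.exp (1 / 2) * P, by positivity, 1 / 2, by norm_num, ?_⟩
  intro n hn w hw hq L
  have hnr : (0 : ℝ) < n := by exact_mod_cast (by omega : 0 < n)
  have hs : 0 < Real.sqrt n := Real.sqrt_pos.2 hnr
  have hsn : Real.sqrt n ≤ n := Real.sqrt_le_iff.2 ⟨hnr.le, by
    have : (1 : ℝ) ≤ n := by exact_mod_cast (by omega : 1 ≤ n)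
    nlinarith⟩
  rw [uniformOfFintype_toOuterMeasure_eq]
  refine ENNReal.ofReal_le_ofReal ?_
  obtain ⟨t, ht, htL⟩ : ∃ t : ℝ, |t| ≤ 1 / 2 ∧ t * L = |L| / 2 := by
    rcases le_total 0 L with h | h
    · exact ⟨1 / 2, by norm_num [abs_of_pos], by rw [abs_of_nonneg h]; ring⟩
    · exact ⟨-(1 / 2), by norm_num [abs_of_pos], by rw [abs_of_nonpos h]; ring⟩
  have h1 := hconc n w hw hq t (L * n) (Real.sqrt n) ht le_rfl
  have h2 : Real.sqrt n / n = 1 / Real.sqrt n := by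
    rw [div_eq_div_iff hnr.ne' hs.ne', Real.mul_self_sqrt hnr.le, one_mul]
  rw [h2] at h1
  have h3 : 𝔼 σ : Equiv.Perm (Fin n), (if |(∑ i, w i * (((σ i : ℕ) : ℝ) + 1)) - L * (n : ℝ)| ≤
      Real.sqrt (n : ℝ) then (1 : ℝ) else 0) =
      𝔼 σ : Equiv.Perm (Fin n), window (L * n) (Real.sqrt n) (firstMoment (w ∘ σ)) := by
    -- Inversion moves the permutation from the positions to the weights; the shift from 0-based to
    -- 1-based values disappears because the weights sum to zero.
    refine Fintype.expect_equiv (Equiv.inv _) _ _ fun σ => ?_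
    have : ∑ i, w i * (((σ i : ℕ) : ℝ) + 1) = firstMoment (w ∘ ⇑(σ⁻¹)) := by
      simp only [mul_add, Finset.sum_add_distrib, mul_one, hw, add_zero, firstMoment]
      refine Fintype.sum_equiv σ _ _ fun i => ?_
      simp [mul_comm]
    rw [this]
    rfl
  rw [h3]
  have h4 : ∀ σ : Equiv.Perm (Fin n), window (L * n) (Real.sqrt n) (firstMoment (w ∘ σ)) ≤
      Real.exp (1 / 2 - |L| / 2) * (window (L * n) (Real.sqrt n) (firstMoment (w ∘ σ)) *
        Real.exp (t / n * firstMoment (w ∘ σ))) := by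
    intro σ
    set W := firstMoment (w ∘ σ)
    unfold window
    split_ifs with h
    · rw [one_mul, ← Real.exp_add]
      refine Real.one_le_exp ?_
      -- On the window, tW/n differs from tL = |L|/2 by at most 1/2, since √n ≤ n; this is the
      -- source of the factor e^{1/2} in C.
      have e1 : |t / n * (W - L * n)| ≤ 1 / 2 := by
        rw [abs_mul, abs_div, abs_of_pos hnr]
        calc |t| / n * |W - L * n| ≤ 1 / 2 / n * n := by
              gcongr; exact h.trans hsn
          _ = 1 / 2 := by field_simp
      have e2 : t / n * W = t / n * (W - L * n) + t * L := by field_simp; ring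
      rw [e2, htL]
      linarith [(abs_le.1 e1).1]
    · simp
  refine (Finset.expect_le_expect fun σ _ => h4 σ).trans ?_
  rw [← Finset.mul_expect]
  refine (mul_le_mul_of_nonneg_left h1 (Real.exp_pos _).le).trans (le_of_eq ?_)
  rw [show (1 : ℝ) / 2 - |L| / 2 = 1 / 2 + -(1 / 2 * |L|) by ring, Real.exp_add]
  ring

end Concentration
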